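/- Let $N\ge 1$ and $(k_1,k_2)=(1,9)$; put $\alpha=\frac{k_1+k_2}{2}=5$ and $\beta=\frac{k_2-k_1}{2}=4$. Let $\mathcal Z$ be the real skew-symmetric $(2N+2)\times(2N+2)$ matrix with, for $1\le i<j\le 2N$, $\mathcal Z_{ij}=\beta$ if $j-i$ is even and $\mathcal Z_{ij}=-\alpha$ if $j-i$ is odd; for $1\le i\le 2N$, $\mathcal Z_{i,2N+1}=-1$ and $\mathcal Z_{i,2N+2}=(-1)^{i+1}$; and $\mathcal Z_{2N+1,2N+2}=0$. Indices $1,\dots,2N$ are read modulo $2N$, and $\mathcal Z^{-1}_r:=(\mathcal Z^{-1})_{i(i+r)}$, which does not depend on $i$. The $(1,9)$ edge theory with $2N$ impurities is a complex Hilbert space of dimension $D_N=\frac{8^N-2^N}{3}$ with unitary operators $U_1,\dots,U_{2N}$ such that $$U_iU_j=e^{2\pi i\,\mathcal Z^{-1}_{ij}}U_jU_i,\qquad U_i^{\beta}U_{i+1}^{-2\alpha}U_{i+2}^{\beta}=\mathbb I,$$ $$U_1U_2\cdots U_{2N}=e^{i\theta_1}\mathbb I,\qquad U_1^{-1}U_2U_3^{-1}\cdots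 U_{2N}=e^{i\theta_2}\mathbb I,\qquad \mathrm{Tr}(U_2U_4\cdots U_{2N})=0,$$ where $\theta_1=\pi\sum_{j=1}^{2N-1}(2N-j)\mathcal Z^{-1}_j+2N\phi$, $\theta_2=\pi\sum_{j=1}^{2N-1}(2N-j)(-1)^j\mathcal Z^{-1}_j$ and $\phi=8\pi\mathcal Z^{-1}_2-40\pi\mathcal Z^{-1}_1+2\pi$. With $\varphi_K=48\pi\mathcal Z^{-1}_1$ and $\varphi_L=\pi(4\mathcal Z^{-1}_2-20\mathcal Z^{-1}_1)$ define $$K_i=e^{i\varphi_K}U_i^4U_{i+1}^{-2}\ (1\le i\le 2N),\qquad L_i=e^{i\varphi_L}U_{2i-1}^2U_{2i}^{-5}U_{2i+1}^2\ (1\le i\le N),$$ $$H_{\rm gap}=-\tfrac12\sum_{i=1}^{2N}(K_i+K_i^\dagger)-\tfrac12\sum_{i=1}^{N}(L_i+L_i^\dagger).$$ Then, in every such edge theory: 1. All the operators $K_i,L_j$ commute with one another, and $K_i^2=K_{i-1}$, $K_{2N}^Q=\mathbb I$ and $L_i^2=\mathbb I$, where $Q=(4^N-1)/3$ is an integer.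 2. For all $m\in\{0,\dots,Q-1\}$ and $\sigma_1,\dots,\sigma_N\in\{\pm1\}$, the joint eigenspace $\{v: K_{2N}v=e^{2\pi i m/Q}v,\ L_iv=\sigma_iv\text{ for all } i\}$ is one-dimensional; unit vectors $|m;\sigma_1,\dots,\sigma_N\rangle$ in these spaces form an orthonormal basis; $K_{2N-n}|m;\sigma\rangle=e^{i2^n2\pi m/Q}|m;\sigma\rangle$ for $0\le n<2N$; and $H_{\rm gap}|m;\sigma\rangle=E(m,\sigma)|m;\sigma\rangle$ with $$E(m,\{\sigma_i\})=-\sum_{n=0}^{2N-1}\cos(2^n2\pi m/Q)-\sum_{i=1}^N\sigma_i .$$ The eigenvalues of $H_{\rm gap}$ are exactly the numbers $E(m,\{\sigma_i\})$. 3. The ground state of $H_{\rm gap}$ is unique: it is the state with $m=0$ and all $\sigma_i=+1$, and every other label has strictly larger energy. 4. Flipping a single $\sigma_i$ in the ground state costs energy $\Delta_{\rm flip}=2$. The clock excitations cost $\Delta_{\rm clock}(m)=E(m,\{\sigma_i=1\})-E(0,\{\sigma_i=1\})=\sum_{n=0}^{2N-1}(1-\cos(2^n2\pi m/Q))$, and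 $\Delta_{\rm clock}(1)\le\Delta_{\rm clock}(m)$ for $1\le m<Q$. The energy gap of $H_{\rm gap}$ (the smallest eigenvalue above the ground state energy, minus the ground state energy) equals $2$ for every $N\ge1$, and $\min(\Delta_{\rm flip},\Delta_{\rm clock}(1))=2$ for $N\ge2$ (for $N=1$ there are no clock excitations). In particular the gap is $2$ in the thermodynamic limit. 5. As $N\to\infty$, $\Delta_{\rm clock}(1)\to\sum_{n=0}^\infty(1-\cos(3\pi2^{-n}))$, a convergent series with value $5.55$ to within $0.005$. -/

import Mathlib

open Complex (exp I)
open scoped Topology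

/-!  Finite dimensional edge theories of the `(k₁, k₂)` impurity model with `2N` impurities, and the
gapping Hamiltonian of the `(1, 9)` edge theory.  The impurities `1, …, 2N` are indexed cyclically by
`ZMod (2 * N)`; the impurity `2N` is the element `0`. -/

namespace ImpurityEdge

noncomputable section

/-- The representative in `{1, …, 2N}` of a site of the cyclic chain. -/
def siteLabel (N : ℕ) (i : ZMod (2 * N)) : ℕ := (i - 1).val + 1

/-- The commutator matrix `𝒵 = (1 / 2πi) [C_i, C_j]` of size `2N + 2`. The summand `ZMod (2 * N)`
indexes the impurities `1, …, 2N`, the summand `Fin 2` the rows and columns `2N + 1`, `2N + 2`.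
With `α = (k₁ + k₂) / 2` and `β = (k₂ - k₁) / 2`, the entry at two impurities `i < j` is `β` if
`j - i` is even and `-α` if `j - i` is odd. -/
def commutatorMatrix (k₁ k₂ N : ℕ) :
    Matrix (ZMod (2 * N) ⊕ Fin 2) (ZMod (2 * N) ⊕ Fin 2) ℝ :=
  let A : Matrix (ZMod (2 * N)) (ZMod (2 * N)) ℝ := Matrix.of fun i j =>
    (Int.sign ((siteLabel N j : ℤ) - (siteLabel N i : ℤ)) : ℝ) *
      (if Even (siteLabel N i + siteLabel N j) then ((k₂ : ℝ) - k₁) / 2 else -(((k₁ : ℝ) + k₂) / 2))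
  let B : Matrix (ZMod (2 * N)) (Fin 2) ℝ := Matrix.of fun i =>
    ![-1, if Odd (siteLabel N i) then 1 else -1]
  Matrix.fromBlocks A B (-B.transpose) 0

variable (k₁ k₂ N : ℕ) [NeZero N]

/-- The entries of `𝒵⁻¹` at two impurities. -/
def zInv (i j : ZMod (2 * N)) : ℝ :=
  (commutatorMatrix k₁ k₂ N)⁻¹ (Sum.inl i) (Sum.inl j)

/-- The abbreviation `𝒵⁻¹_r = 𝒵⁻¹_{i (i + r)}`, read off at `i = 1`. -/
def zInvRel (r : ZMod (2 * N)) : ℝ := zInv k₁ k₂ N 1 (1 + r)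

/-- The phase `φ` in `U_i = e^{i Γ_i + i φ}`. -/
def phaseU : ℝ :=
  Real.pi / (8 * k₁) * ((k₂ : ℝ) - k₁) ^ 2 * zInvRel k₁ k₂ N 2
    - Real.pi * ((k₂ : ℝ) ^ 2 - (k₁ : ℝ) ^ 2) / (2 * k₁) * zInvRel k₁ k₂ N 1
    + Real.pi * ((k₂ : ℝ) - k₁) / (4 * k₁)

/-- The boundary phase `θ₁`. -/
def theta₁ : ℝ :=
  Real.pi * ∑ j ∈ Finset.Icc 1 (2 * N - 1), (2 * (N : ℝ) - j) * zInvRel k₁ k₂ N (j : ZMod (2 * N))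
    + 2 * N * phaseU k₁ k₂ N

/-- The boundary phase `θ₂`. -/
def theta₂ : ℝ :=
  Real.pi * ∑ j ∈ Finset.Icc 1 (2 * N - 1),
    (2 * (N : ℝ) - j) * (-1) ^ j * zInvRel k₁ k₂ N (j : ZMod (2 * N))

/-- The ground state degeneracy `D_N` of the impurity model. -/
def degeneracy (k₁ k₂ N : ℕ) : ℝ :=
  ((((k₁ : ℝ) + k₂) / 2 + √((k₁ : ℝ) * k₂)) ^ N - (((k₁ : ℝ) + k₂) / 2 - √((k₁ : ℝ) * k₂)) ^ N) /
    √((k₁ : ℝ) * k₂)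

/-- The `(k₁, k₂)` edge theory (`k₁, k₂` odd) with `2N` impurities on the Hilbert space `V`: a
`D_N`-dimensional unitary representation of the defining operator algebra of the `U_i`. -/
structure EdgeTheory (V : Type*) [NormedAddCommGroup V] [InnerProductSpace ℂ V]
    [FiniteDimensional ℂ V] where
  /-- The basic local operators; they are unitary, `U_i⁻¹ = U_i†`. -/
  U : ZMod (2 * N) → unitary (Module.End ℂ V)
  /-- The Hilbert space has dimension `D_N`. -/
  finrank_eq : (Module.finrank ℂ V : ℝ) = degeneracy k₁ k₂ N
  /-- `U_i U_j = e^{2πi 𝒵⁻¹_{ij}} U_j U_i`. -/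
  U_mul_U : ∀ i j, (U i * U j : Module.End ℂ V) =
    exp (2 * Real.pi * I * zInv k₁ k₂ N i j) • (U j * U i : Module.End ℂ V)
  /-- `U_i^β U_{i+1}^{-2α} U_{i+2}^β = 𝕀`, where `2α = k₁ + k₂` and `β = (k₂ - k₁) / 2`. -/
  U_relation : ∀ i, U i ^ (((k₂ : ℤ) - k₁) / 2) * U (i + 1) ^ (-((k₁ : ℤ) + k₂)) *
    U (i + 2) ^ (((k₂ : ℤ) - k₁) / 2) = 1
  /-- `U_1 U_2 ⋯ U_{2N} = e^{i θ₁} 𝕀`. -/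
  prod_U : (((List.range (2 * N)).map fun l : ℕ => U ((l + 1 : ℕ) : ZMod (2 * N))).prod :
    Module.End ℂ V) = exp (I * theta₁ k₁ k₂ N) • (1 : Module.End ℂ V)
  /-- `U_1⁻¹ U_2 U_3⁻¹ ⋯ U_{2N} = e^{i θ₂} 𝕀`. -/
  prod_U_alternating :
    (((List.range (2 * N)).map fun l : ℕ => U ((l + 1 : ℕ) : ZMod (2 * N)) ^ ((-1 : ℤ) ^ (l + 1))).prod :
    Module.End ℂ V) = exp (I * theta₂ k₁ k₂ N) • (1 : Module.End ℂ V)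
  /-- `Tr (U_2 U_4 ⋯ U_{2N}) = 0`. -/
  trace_prod_even : LinearMap.trace ℂ V
    (((List.range N).map fun l : ℕ => U ((2 * (l + 1) : ℕ) : ZMod (2 * N))).prod : Module.End ℂ V) = 0

/-- The phase `φ_K` for `(k₁, k₂) = (1, 9)`. -/
def phaseK : ℝ := 48 * Real.pi * zInvRel 1 9 N 1

/-- The phase `φ_L` for `(k₁, k₂) = (1, 9)`. -/
def phaseL : ℝ := Real.pi * (4 * zInvRel 1 9 N 2 - 20 * zInvRel 1 9 N 1)

/-- `Q = (4^N - 1) / 3` (the division is exact). -/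
def clockOrder (N : ℕ) : ℕ := (4 ^ N - 1) / 3

/-- `E(m, {σ_i}) = - ∑_{n=0}^{2N-1} cos (2^n 2πm / Q) - ∑_i σ_i`. -/
def energy (N m : ℕ) (σ : Fin N → ℤˣ) : ℝ :=
  - ∑ n ∈ Finset.range (2 * N), Real.cos (2 ^ n * (2 * Real.pi * m) / clockOrder N)
    - ∑ i, (((σ i : ℤˣ) : ℤ) : ℝ)

/-- The clock excitation energy `Δ_clock(m) = E(m, {σ_i = 1}) - E(0, {σ_i = 1})`. -/
def clockGap (N m : ℕ) : ℝ := energy N m 1 - energy N 0 1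

namespace EdgeTheory

variable {N : ℕ} [NeZero N] {V : Type*} [NormedAddCommGroup V] [InnerProductSpace ℂ V]
  [FiniteDimensional ℂ V] (𝓔 : EdgeTheory 1 9 N V)

/-- `K_i = e^{i φ_K} U_i^4 U_{i+1}^{-2}`. -/
def K (i : ZMod (2 * N)) : Module.End ℂ V :=
  exp (I * phaseK N) • ((𝓔.U i ^ (4 : ℤ) * 𝓔.U (i + 1) ^ (-2 : ℤ) : unitary (Module.End ℂ V)) :
    Module.End ℂ V)

/-- `L_i = e^{i φ_L} U_{2i-1}^2 U_{2i}^{-5} U_{2i+1}^2`, where `j : Fin N` stands for `i = j + 1`. -/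
def L (j : Fin N) : Module.End ℂ V :=
  exp (I * phaseL N) • ((𝓔.U ((2 * (j : ℕ) + 1 : ℕ) : ZMod (2 * N)) ^ (2 : ℤ) *
      𝓔.U ((2 * (j : ℕ) + 2 : ℕ) : ZMod (2 * N)) ^ (-5 : ℤ) *
      𝓔.U ((2 * (j : ℕ) + 3 : ℕ) : ZMod (2 * N)) ^ (2 : ℤ) : unitary (Module.End ℂ V)) :
    Module.End ℂ V)

/-- `H_gap = - (1/2) ∑_{i=1}^{2N} (K_i + h.c.) - (1/2) ∑_{i=1}^{N} (L_i + h.c.)`. -/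
def H : Module.End ℂ V :=
  -((1 / 2 : ℂ) • ∑ i, (𝓔.K i + star (𝓔.K i))) - (1 / 2 : ℂ) • ∑ j, (𝓔.L j + star (𝓔.L j))

/-- The joint eigenspace of `K_{2N}, L_1, …, L_N` labelled by `(m, σ_1, …, σ_N)`. -/
def jointEigenspace (m : ℕ) (σ : Fin N → ℤˣ) : Submodule ℂ V :=
  (𝓔.K ((2 * N : ℕ) : ZMod (2 * N))).eigenspace (exp (2 * Real.pi * I * m / clockOrder N)) ⊓
    ⨅ j, (𝓔.L j).eigenspace (((σ j : ℤˣ) : ℤ) : ℂ)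

end EdgeTheory

end

end ImpurityEdge

open ImpurityEdge

/-!
After dividing out suitable phases, the ordered monomials in the `U_i` form a Weyl system on
`ℤ^{2N}`: unitaries `W a` with `W a * W b = e^{iπ⟨a, b⟩} W (a + b)`, where `⟨·, ·⟩` is the form of
`𝒵⁻¹`, and the defining relations of the theory say `W a = 1` for the relation vectors, for
`(1, …, 1)` and for `(-1, 1, …, -1, 1)`. Each `K_i` and `L_i` is one of these Weyl operators, so the
relations between them follow from the recurrence that the entries of `𝒵⁻¹` satisfy. A nontrivial
product of powers of `K_{2N}` and of the `L_i` is traceless: it is conjugate to a multiple of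
itself by a scalar other than `1`, or it is a multiple of `U_2 U_4 ⋯ U_{2N}`. Hence
`ℤ/Q × (ℤ/2)^N` acts with every character occurring `D_N / (2^N Q) = 1` times.

The clock energy of `m` is the sum of the costs `1 - cos θ` along the orbit of `m` under doubling
in `ℤ/Q`. The cost `c` evolves by `c ↦ 2c(2 - c)`, and a potential function shows that each visit
of the orbit to the arc where the doubling map folds contributes at least `3/2`. The sign of the
representative of least absolute value flips at each such visit, so their number is even: a
nonzero orbit costs at least `3 > 2`, one with four or more visits costs at least `6`, and one
with two visits is either the orbit of `1` or again costs at least `6`. Finally,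
`F x = ∑ (1 - cos (x / 2^n))` telescopes under doubling to `Δ_clock(1) = F (3π + π/Q) - F (π/Q)`.
-/

namespace ImpurityEdge

section CommutatorMatrix

variable {N : ℕ}

lemma siteLabel_pos (i : ZMod (2 * N)) : 0 < siteLabel N i := Nat.succ_pos _

/-- The alternating sign of a site: `-1` at odd impurities, `1` at even ones. -/
def siteSign (i : ZMod (2 * N)) : ℤ := (-1) ^ siteLabel N i

lemma siteSign_mul_self (i : ZMod (2 * N)) : siteSign i * siteSign i = 1 := by
  rw [siteSign, ← mul_pow, neg_one_mul, neg_neg, one_pow]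

lemma siteSign_mul_self_real (i : ZMod (2 * N)) : (siteSign i : ℝ) * siteSign i = 1 := by
  exact_mod_cast siteSign_mul_self i

lemma siteSign_eq_ite (i : ZMod (2 * N)) :
    (siteSign i : ℝ) = if Odd (siteLabel N i) then -1 else 1 := by
  split_ifs with h
  · simp [siteSign, h.neg_one_pow]
  · simp [siteSign, (Nat.not_odd_iff_even.1 h).neg_one_pow]

section Entries

variable (k₁ k₂ : ℕ)

/-- The entry `β` or `-α` of the commutator matrix above its diagonal, in terms of the parities. -/
noncomputable def parityCoeff (i j : ZMod (2 * N)) : ℝ :=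
  -(k₁ / 2) + k₂ / 2 * (siteSign i * siteSign j)

lemma parityCoeff_self (i : ZMod (2 * N)) : parityCoeff k₁ k₂ i i = (k₂ - k₁) / 2 := by
  rw [parityCoeff, siteSign_mul_self_real]; ring

lemma parityCoeff_comm (i j : ZMod (2 * N)) : parityCoeff k₁ k₂ i j = parityCoeff k₁ k₂ j i := by
  rw [parityCoeff, parityCoeff, mul_comm (siteSign i : ℝ)]

lemma commutatorMatrix_inl_inl (i j : ZMod (2 * N)) :
    commutatorMatrix k₁ k₂ N (Sum.inl i) (Sum.inl j) =
      ((siteLabel N j : ℤ) - siteLabel N i).sign * parityCoeff k₁ k₂ i j := by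
  simp only [commutatorMatrix, Matrix.fromBlocks_apply₁₁, Matrix.of_apply, parityCoeff,
    siteSign_eq_ite, Nat.even_add, ← Nat.not_even_iff_odd]
  by_cases hi : Even (siteLabel N i) <;> by_cases hj : Even (siteLabel N j) <;>
    simp only [hi, hj, iff_true, iff_false, not_true, not_false_iff, if_true, if_false] <;> ring

lemma commutatorMatrix_inl_inr_zero (i : ZMod (2 * N)) :
    commutatorMatrix k₁ k₂ N (Sum.inl i) (Sum.inr 0) = -1 := by
  simp [commutatorMatrix]

lemma commutatorMatrix_inl_inr_one (i : ZMod (2 * N)) :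
    commutatorMatrix k₁ k₂ N (Sum.inl i) (Sum.inr 1) = -siteSign i := by
  rw [siteSign_eq_ite]
  simp only [commutatorMatrix, Matrix.fromBlocks_apply₁₂, Matrix.of_apply, Matrix.cons_val_one,
    Matrix.cons_val_zero]
  split_ifs <;> simp

lemma transpose_commutatorMatrix :
    (commutatorMatrix k₁ k₂ N).transpose = -commutatorMatrix k₁ k₂ N := by
  ext (i | i) (j | j)
  · rw [Matrix.transpose_apply, Matrix.neg_apply, commutatorMatrix_inl_inl,
      commutatorMatrix_inl_inl, ← neg_sub (siteLabel N j : ℤ), Int.sign_neg, parityCoeff_comm]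
    push_cast; ring
  all_goals simp [commutatorMatrix]

end Entries

variable [NeZero N]

lemma siteLabel_le (i : ZMod (2 * N)) : siteLabel N i ≤ 2 * N := ZMod.val_lt (i - 1)

lemma siteLabel_injective : Function.Injective (siteLabel N) := fun _ _ h =>
  sub_left_injective (ZMod.val_injective _ (Nat.succ_injective h))

lemma siteLabel_add_one (i : ZMod (2 * N)) :
    siteLabel N (i + 1) = if siteLabel N i = 2 * N then 1 else siteLabel N i + 1 := by
  have hval : i.val = siteLabel N i % (2 * N) := by
    rw [siteLabel, ← Nat.add_mod_mod, ← ZMod.val_one_eq_one_mod, ← ZMod.val_add, sub_add_cancel]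
  have hlt := siteLabel_le i
  rw [siteLabel, add_sub_cancel_right, hval]
  split_ifs with h
  · rw [h, Nat.mod_self]
  · rw [Nat.mod_eq_of_lt (by lia)]

lemma siteLabel_zero : siteLabel N 0 = 2 * N := by
  have h := siteLabel_add_one (0 : ZMod (2 * N))
  have hpos := siteLabel_pos (0 : ZMod (2 * N))
  rw [zero_add, siteLabel, sub_self, ZMod.val_zero, zero_add] at h
  split_ifs at h with h'
  · exact h'
  · lia

lemma siteSign_add_one (i : ZMod (2 * N)) : siteSign (i + 1) = -siteSign i := by
  rw [siteSign, siteSign, siteLabel_add_one]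
  split_ifs with h
  · simp [h]
  · rw [pow_succ, mul_neg_one]

lemma siteSign_add_two (i : ZMod (2 * N)) : siteSign (i + 2) = siteSign i := by
  rw [show i + 2 = i + 1 + 1 by ring, siteSign_add_one, siteSign_add_one, neg_neg]

lemma siteSign_natCast (n : ℕ) : siteSign (n : ZMod (2 * N)) = (-1) ^ n := by
  induction n with
  | zero => simp [siteSign, siteLabel_zero]
  | succ n ih => rw [Nat.cast_succ, siteSign_add_one, ih, pow_succ, mul_neg_one]

lemma siteSign_neg (i : ZMod (2 * N)) : siteSign (-i) = siteSign i := by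
  rw [← ZMod.natCast_zmod_val i]
  generalize i.val = n
  induction n with
  | zero => simp
  | succ n ih =>
    rw [Nat.cast_succ, siteSign_add_one, ← ih, ← neg_neg (siteSign (-(_ + 1))), ← siteSign_add_one]
    congr 2; ring

lemma sum_siteSign : ∑ i : ZMod (2 * N), siteSign i = 0 := by
  have h := Equiv.sum_comp (Equiv.addRight (1 : ZMod (2 * N))) siteSign
  simp only [Equiv.coe_addRight, siteSign_add_one, Finset.sum_neg_distrib] at h
  lia

lemma sign_siteLabel_sub_add_one (i j : ZMod (2 * N)) :
    ((siteLabel N j : ℤ) - siteLabel N (i + 1)).sign - ((siteLabel N j : ℤ) - siteLabel N i).sign =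
      2 * (if siteLabel N i = 2 * N then 1 else 0) - (if j = i then 1 else 0) -
        if j = i + 1 then 1 else 0 := by
  have hi := siteLabel_pos i
  have hj := siteLabel_pos j
  have hj' := siteLabel_le j
  simp only [← (siteLabel_injective (N := N)).eq_iff, siteLabel_add_one]
  grind

variable (k₁ k₂ : ℕ)

lemma parityCoeff_add_one (i : ZMod (2 * N)) : parityCoeff k₁ k₂ i (i + 1) = -((k₁ + k₂) / 2) := by
  rw [parityCoeff, siteSign_add_one, Int.cast_neg, mul_neg, siteSign_mul_self_real]; ring

lemma parityCoeff_add_two_right (i j : ZMod (2 * N)) :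
    parityCoeff k₁ k₂ i (j + 2) = parityCoeff k₁ k₂ i j := by
  rw [parityCoeff, siteSign_add_two, parityCoeff]

lemma commutatorMatrix_mulVec_inl (x : ZMod (2 * N) ⊕ Fin 2 → ℝ) (i : ZMod (2 * N)) :
    (commutatorMatrix k₁ k₂ N).mulVec x (Sum.inl i) =
      (∑ j, commutatorMatrix k₁ k₂ N (Sum.inl i) (Sum.inl j) * x (Sum.inl j))
        - x (Sum.inr 0) - siteSign i * x (Sum.inr 1) := by
  simp only [Matrix.mulVec, dotProduct, Fintype.sum_sum_type, Fin.sum_univ_two,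
    commutatorMatrix_inl_inr_zero, commutatorMatrix_inl_inr_one]
  ring

lemma commutatorMatrix_mulVec_inr_zero (x : ZMod (2 * N) ⊕ Fin 2 → ℝ) :
    (commutatorMatrix k₁ k₂ N).mulVec x (Sum.inr 0) = ∑ j, x (Sum.inl j) := by
  simp [commutatorMatrix, Matrix.mulVec, dotProduct]

lemma commutatorMatrix_mulVec_inr_one (x : ZMod (2 * N) ⊕ Fin 2 → ℝ) :
    (commutatorMatrix k₁ k₂ N).mulVec x (Sum.inr 1) = ∑ j, (siteSign j : ℝ) * x (Sum.inl j) := by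
  have hcol (j : ZMod (2 * N)) :
      commutatorMatrix k₁ k₂ N (Sum.inr 1) (Sum.inl j) = siteSign j := by
    have h := congrFun₂ (transpose_commutatorMatrix k₁ k₂ (N := N)) (Sum.inl j) (Sum.inr 1)
    rwa [Matrix.transpose_apply, Matrix.neg_apply, commutatorMatrix_inl_inr_one, neg_neg] at h
  have hzero (k : Fin 2) : commutatorMatrix k₁ k₂ N (Sum.inr 1) (Sum.inr k) = 0 := rfl
  simp only [Matrix.mulVec, dotProduct, Fintype.sum_sum_type, hcol, hzero, zero_mul,
    Finset.sum_const_zero, add_zero]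

-- The indicators of the label `2N` are the effect of the labels wrapping around from `2N` to `1`.
lemma commutatorMatrix_add_two_sub (i j : ZMod (2 * N)) :
    commutatorMatrix k₁ k₂ N (Sum.inl (i + 2)) (Sum.inl j) -
        commutatorMatrix k₁ k₂ N (Sum.inl i) (Sum.inl j) =
      (2 * ((if siteLabel N i = 2 * N then 1 else 0) +
          (if siteLabel N (i + 1) = 2 * N then 1 else 0)) - (if j = i then 1 else 0) -
        2 * (if j = i + 1 then 1 else 0) - (if j = i + 2 then 1 else 0)) *
          parityCoeff k₁ k₂ i j := by
  have htwo : i + 1 + 1 = i + 2 := by ring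
  have h := congrArg₂ (· + ·) (sign_siteLabel_sub_add_one i j)
    (sign_siteLabel_sub_add_one (i + 1) j)
  have h' := congrArg (Int.cast : ℤ → ℝ) h
  rw [htwo] at h'
  push_cast at h'
  rw [commutatorMatrix_inl_inl, commutatorMatrix_inl_inl, parityCoeff_comm _ _ (i + 2),
    parityCoeff_add_two_right, parityCoeff_comm _ _ j, ← sub_mul]
  congr 1
  linear_combination h'

lemma sum_parityCoeff_mul {v : ZMod (2 * N) → ℝ} (hsum : ∑ j, v j = 0)
    (hsum' : ∑ j, (siteSign j : ℝ) * v j = 0) (i : ZMod (2 * N)) :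
    ∑ j, parityCoeff k₁ k₂ i j * v j = 0 := by
  calc ∑ j, parityCoeff k₁ k₂ i j * v j
      = -(k₁ / 2) * ∑ j, v j + k₂ / 2 * siteSign i * ∑ j, siteSign j * v j := by
        rw [Finset.mul_sum, Finset.mul_sum, ← Finset.sum_add_distrib]
        exact Finset.sum_congr rfl fun j _ => by rw [parityCoeff]; ring
    _ = 0 := by rw [hsum, hsum', mul_zero, mul_zero, add_zero]

lemma sum_commutatorMatrix_add_two_sub {v : ZMod (2 * N) → ℝ} (hsum : ∑ j, v j = 0)
    (hsum' : ∑ j, (siteSign j : ℝ) * v j = 0) (i : ZMod (2 * N)) :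
    (∑ j, commutatorMatrix k₁ k₂ N (Sum.inl (i + 2)) (Sum.inl j) * v j) -
        ∑ j, commutatorMatrix k₁ k₂ N (Sum.inl i) (Sum.inl j) * v j =
      (k₁ + k₂) * v (i + 1) - (k₂ - k₁) / 2 * (v i + v (i + 2)) := by
  simp only [← Finset.sum_sub_distrib, ← sub_mul, commutatorMatrix_add_two_sub]
  simp only [sub_mul, mul_assoc, Finset.sum_sub_distrib, ← Finset.mul_sum,
    sum_parityCoeff_mul k₁ k₂ hsum hsum', ite_mul, one_mul, zero_mul, Finset.sum_ite_eq',
    Finset.mem_univ, if_true, parityCoeff_self, parityCoeff_add_one, parityCoeff_add_two_right]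
  ring

lemma recurrence_of_mulVec {x y : ZMod (2 * N) ⊕ Fin 2 → ℝ}
    (hxy : (commutatorMatrix k₁ k₂ N).mulVec x = y) (hy₀ : y (Sum.inr 0) = 0)
    (hy₁ : y (Sum.inr 1) = 0) (i : ZMod (2 * N)) :
    (k₁ + k₂) * x (Sum.inl (i + 1)) - (k₂ - k₁) / 2 * (x (Sum.inl i) + x (Sum.inl (i + 2))) =
      y (Sum.inl (i + 2)) - y (Sum.inl i) := by
  subst hxy
  rw [commutatorMatrix_mulVec_inr_zero] at hy₀
  rw [commutatorMatrix_mulVec_inr_one] at hy₁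
  rw [← sum_commutatorMatrix_add_two_sub k₁ k₂ hy₀ hy₁, commutatorMatrix_mulVec_inl,
    commutatorMatrix_mulVec_inl, siteSign_add_two]
  ring

variable {k₁ k₂} [NeZero k₁] [NeZero k₂]

-- A maximum principle: as `k₁ + k₂` exceeds `|k₂ - k₁|`, `|v|` cannot have a positive maximum.
lemma eq_zero_of_recurrence {v : ZMod (2 * N) → ℝ}
    (h : ∀ i, (k₁ + k₂) * v (i + 1) - (k₂ - k₁) / 2 * (v i + v (i + 2)) = 0) : v = 0 := by
  obtain ⟨m, hm⟩ := Finite.exists_max fun i => |v i|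
  have hrec := h (m - 1)
  rw [sub_add_cancel] at hrec
  have hk₁ : (0 : ℝ) < k₁ := Nat.cast_pos.2 (NeZero.pos k₁)
  have hk₂ : (0 : ℝ) < k₂ := Nat.cast_pos.2 (NeZero.pos k₂)
  have hk : |(k₂ : ℝ) - k₁| < k₁ + k₂ := abs_lt.2 ⟨by linarith, by linarith⟩
  have hle : (k₁ + k₂) * |v m| ≤ |(k₂ : ℝ) - k₁| * |v m| := by
    calc (k₁ + k₂) * |v m| = |(k₂ - k₁) / 2 * (v (m - 1) + v (m - 1 + 2))| := by
          rw [← sub_eq_zero.1 hrec, abs_mul, abs_of_pos (add_pos hk₁ hk₂)]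
      _ = |(k₂ : ℝ) - k₁| / 2 * |v (m - 1) + v (m - 1 + 2)| := by
          rw [abs_mul, abs_div, abs_two]
      _ ≤ |(k₂ : ℝ) - k₁| / 2 * (|v m| + |v m|) := by
          gcongr
          exact (abs_add_le _ _).trans (add_le_add (hm _) (hm _))
      _ = |(k₂ : ℝ) - k₁| * |v m| := by ring
  have hmax : |v m| ≤ 0 := by
    by_contra! hpos
    exact absurd (le_of_mul_le_mul_right hle hpos) hk.not_ge
  exact funext fun i => abs_nonpos_iff.1 ((hm i).trans hmax)

lemma isUnit_det_commutatorMatrix : IsUnit (commutatorMatrix k₁ k₂ N).det := by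
  rw [isUnit_iff_ne_zero]
  intro hdet
  obtain ⟨x, hx, hx₀⟩ := Matrix.exists_mulVec_eq_zero_iff.2 hdet
  have hinl (i : ZMod (2 * N)) : x (Sum.inl i) = 0 := congrFun
    (eq_zero_of_recurrence (v := fun i => x (Sum.inl i)) fun i => by
      rw [recurrence_of_mulVec k₁ k₂ hx₀ rfl rfl i]; exact sub_self _) i
  have hinr (i : ZMod (2 * N)) : x (Sum.inr 0) + siteSign i * x (Sum.inr 1) = 0 := by
    have h := commutatorMatrix_mulVec_inl k₁ k₂ x i
    simp only [hx₀, hinl, Pi.zero_apply, mul_zero, Finset.sum_const_zero] at h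
    linarith
  have heven := hinr 0
  have hodd := hinr (0 + 1)
  rw [siteSign_add_one] at hodd
  simp only [siteSign, siteLabel_zero, even_two_mul, Even.neg_pow, one_pow, Int.cast_one,
    Int.cast_neg] at heven hodd
  refine hx (funext ?_)
  rintro (i | k)
  · exact hinl i
  · fin_cases k
    · change x (Sum.inr 0) = 0
      linarith
    · change x (Sum.inr 1) = 0
      linarith

variable (k₁ k₂)

lemma zInv_recurrence (i j : ZMod (2 * N)) :
    (k₂ - k₁) / 2 * (zInv k₁ k₂ N i j + zInv k₁ k₂ N (i + 2) j) -
        (k₁ + k₂) * zInv k₁ k₂ N (i + 1) j =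
      (if i = j then 1 else 0) - if i + 2 = j then 1 else 0 := by
  have hcol : (commutatorMatrix k₁ k₂ N).mulVec ((commutatorMatrix k₁ k₂ N)⁻¹.col (Sum.inl j)) =
      Pi.single (Sum.inl j) 1 := by
    rw [← Matrix.mulVec_single_one, Matrix.mulVec_mulVec,
      Matrix.mul_nonsing_inv _ isUnit_det_commutatorMatrix, Matrix.one_mulVec]
  have h := recurrence_of_mulVec k₁ k₂ hcol (by simp) (by simp) i
  simp only [Pi.single_apply, Sum.inl.injEq, Matrix.col_apply] at h
  simp only [zInv]
  linarith

lemma zInv_skew (i j : ZMod (2 * N)) : zInv k₁ k₂ N j i = -zInv k₁ k₂ N i j := by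
  have hinv : (-commutatorMatrix k₁ k₂ N)⁻¹ = -(commutatorMatrix k₁ k₂ N)⁻¹ :=
    Matrix.inv_eq_left_inv <| by
      rw [neg_mul_neg, Matrix.nonsing_inv_mul _ isUnit_det_commutatorMatrix]
  have h := Matrix.transpose_nonsing_inv (commutatorMatrix k₁ k₂ N)
  rw [transpose_commutatorMatrix, hinv] at h
  exact congrFun₂ h (Sum.inl i) (Sum.inl j)

lemma zInv_add_one_add_one (i j : ZMod (2 * N)) :
    zInv k₁ k₂ N (i + 1) (j + 1) = zInv k₁ k₂ N i j := by
  have h := eq_zero_of_recurrence (k₁ := k₁) (k₂ := k₂)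
    (v := fun i => zInv k₁ k₂ N (i + 1) (j + 1) - zInv k₁ k₂ N i j) fun i => by
      have h := zInv_recurrence k₁ k₂ (i + 1) (j + 1)
      rw [add_right_comm i 1 2] at h
      simp only [add_left_inj] at h
      linear_combination zInv_recurrence k₁ k₂ i j - h
  exact sub_eq_zero.1 (congrFun h i)

lemma zInv_eq_zInvRel (i j : ZMod (2 * N)) : zInv k₁ k₂ N i j = zInvRel k₁ k₂ N (j - i) := by
  have hshift (n : ℕ) (i j : ZMod (2 * N)) : zInv k₁ k₂ N (i + n) (j + n) = zInv k₁ k₂ N i j := by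
    induction n with
    | zero => simp
    | succ n ih => rw [Nat.cast_succ, ← add_assoc, ← add_assoc, zInv_add_one_add_one, ih]
  rw [zInvRel, ← hshift (i - 1).val 1, ZMod.natCast_zmod_val]
  congr 1 <;> ring

lemma zInvRel_recurrence :
    (k₂ - k₁) / 2 * zInvRel k₁ k₂ N 2 - (k₁ + k₂) * zInvRel k₁ k₂ N 1 =
      (if (2 : ZMod (2 * N)) = 0 then 1 else 0) - 1 := by
  have hself : zInvRel k₁ k₂ N 0 = 0 := by
    have h := zInv_skew k₁ k₂ (0 : ZMod (2 * N)) 0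
    rw [zInv_eq_zInvRel, sub_self] at h
    linarith
  have h := zInv_recurrence k₁ k₂ (0 : ZMod (2 * N)) 2
  simp only [zInv_eq_zInvRel, zero_add, sub_zero, sub_self, hself, add_zero, if_true,
    eq_comm (a := (0 : ZMod (2 * N)))] at h
  rwa [show (2 - 1 : ZMod (2 * N)) = 1 by ring] at h

end CommutatorMatrix

section Weyl

variable {A Φ G : Type*} [AddCommGroup A] [AddCommGroup Φ] [Group G]
  {z : AddChar Φ (Subgroup.center G)}

lemma mul_addChar_center (g : G) (t : Φ) : g * z t = z t * g := ((z t).2.comm g).eq.symm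

lemma mul_addChar_center_mul (g : G) (t : Φ) (x : G) : g * (z t * x) = z t * (g * x) := by
  rw [← mul_assoc, mul_addChar_center, mul_assoc]

lemma addChar_center_mul_mul (s t : Φ) (x : G) : z s * (z t * x) = z (s + t) * x := by
  rw [AddChar.map_add_eq_mul, Subgroup.coe_mul, mul_assoc]

lemma addChar_center_mul_mul_mul (s t : Φ) (x y : G) :
    z s * x * (z t * y) = z (s + t) * (x * y) := by
  rw [mul_assoc, mul_addChar_center_mul, addChar_center_mul_mul]

lemma prod_range_addChar_center_mul (t : ℕ → Φ) (x : ℕ → G) (n : ℕ) :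
    ((List.range n).map fun l => z (t l) * x l).prod =
      z (∑ l ∈ Finset.range n, t l) * ((List.range n).map x).prod := by
  induction n with
  | zero => simp
  | succ n ih =>
    rw [List.range_succ, List.map_append, List.map_append, List.prod_append, List.prod_append, ih,
      List.map_singleton, List.map_singleton, List.prod_singleton, List.prod_singleton,
      Finset.sum_range_succ, addChar_center_mul_mul_mul]

lemma eq_addChar_center_neg_mul {t : Φ} {x y : G} (h : x = z t * y) : y = z (-t) * x := by
  rw [h, AddChar.map_neg_eq_inv, Subgroup.coe_inv, inv_mul_cancel_left]

lemma zpow_mul_eq_of_mul_eq {t : Φ} {x y : G} (h : x * y = z t * (y * x)) (n : ℤ) :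
    x ^ n * y = z (n • t) * (y * x ^ n) := by
  have hsemi : SemiconjBy y (z t * x) x := by
    rw [SemiconjBy, h, ← mul_assoc, mul_addChar_center, mul_assoc]
  have hcomm : Commute (z t : G) x := (z t).2.comm x
  rw [← (hsemi.zpow_right n).eq, hcomm.mul_zpow, ← Subgroup.coe_zpow, ← AddChar.map_zsmul_eq_zpow,
    ← mul_assoc, mul_addChar_center, mul_assoc]

/-- The map `T` is a projective representation of `A` by Weyl operators: its cocycle is given by the
alternating bilinear form `B`, read in the center of `G` through the character `z`. -/
structure IsWeylSystem (z : AddChar Φ (Subgroup.center G)) (B : LinearMap.BilinMap ℤ A Φ)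
    (T : A → G) : Prop where
  isAlt : B.IsAlt
  map_mul : ∀ a b, T a * T b = z (B a b) * T (a + b)

namespace IsWeylSystem

variable {B : LinearMap.BilinMap ℤ A Φ} {T : A → G}

section

variable (hT : IsWeylSystem z B T)
include hT

lemma map_zero : T 0 = 1 := by simpa using hT.map_mul 0 0

lemma mul_comm_phase (a b : A) : T a * T b = z ((2 : ℤ) • B a b) * (T b * T a) := by
  rw [hT.map_mul b a, hT.map_mul a b, add_comm b a, addChar_center_mul_mul, ← hT.isAlt.neg b a,
    two_zsmul]
  simp

lemma commute {a b : A} (h : z ((2 : ℤ) • B a b) = 1) : Commute (T a) (T b) := by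
  rw [Commute, SemiconjBy, hT.mul_comm_phase, h, Subgroup.coe_one, one_mul]

lemma map_add_of_eq_zero {a b : A} (h : B a b = 0) : T (a + b) = T a * T b := by
  rw [hT.map_mul, h, AddChar.map_zero_eq_one, Subgroup.coe_one, one_mul]

lemma map_neg (a : A) : T (-a) = (T a)⁻¹ := by
  rw [eq_inv_iff_mul_eq_one, ← hT.map_add_of_eq_zero (by simp [hT.isAlt a]), neg_add_cancel,
    hT.map_zero]

lemma map_zsmul (a : A) (n : ℤ) : T (n • a) = T a ^ n := by
  induction n using Int.induction_on with
  | zero => rw [zero_smul, hT.map_zero, zpow_zero]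
  | succ n ih =>
    rw [zpow_add_one, ← ih, add_smul, one_smul, hT.map_add_of_eq_zero (by simp [hT.isAlt a])]
  | pred n ih =>
    rw [zpow_sub_one, ← ih, ← hT.map_neg, sub_smul, one_smul, sub_eq_add_neg,
      hT.map_add_of_eq_zero (by simp [hT.isAlt a])]

lemma prod_range (v : ℕ → A) (n : ℕ) :
    ((List.range n).map fun l => T (v l)).prod =
      z (∑ q ∈ Finset.range n, ∑ p ∈ Finset.range q, B (v p) (v q)) *
        T (∑ l ∈ Finset.range n, v l) := by
  induction n with
  | zero => simp [hT.map_zero]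
  | succ n ih =>
    rw [List.range_succ, List.map_append, List.prod_append, ih, List.map_singleton,
      List.prod_singleton, mul_assoc, hT.map_mul, addChar_center_mul_mul, map_sum,
      LinearMap.sum_apply, Finset.sum_range_succ, Finset.sum_range_succ]

end

lemma extend {p : A →ₗ[ℤ] A} (hB : B.IsAlt) (hT : IsWeylSystem z (B.compl₁₂ p p) T)
    {u : G} {e : A} (hu : ∀ a, T a * u = z ((2 : ℤ) • B (p a) e) * (u * T a)) (n : A →ₗ[ℤ] ℤ) :
    IsWeylSystem z (B.compl₁₂ (p + n.smulRight e) (p + n.smulRight e)) fun a =>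
      z (-(n a • B (p a) e)) * (T a * u ^ n a) where
  isAlt a := hB _
  map_mul a b := by
    have hu' : u ^ n a * T b = z (n a • -((2 : ℤ) • B (p b) e)) * (T b * u ^ n a) :=
      zpow_mul_eq_of_mul_eq (eq_addChar_center_neg_mul (hu b)) (n a)
    have hswap : B e (p b) = -B (p b) e := (hB.neg _ _).symm
    calc z (-(n a • B (p a) e)) * (T a * u ^ n a) * (z (-(n b • B (p b) e)) * (T b * u ^ n b))
        = z (-(n a • B (p a) e) + -(n b • B (p b) e)) * (T a * (u ^ n a * T b) * u ^ n b) := by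
          rw [addChar_center_mul_mul_mul]
          simp only [mul_assoc]
      _ = z (-(n a • B (p a) e) + -(n b • B (p b) e) + n a • -((2 : ℤ) • B (p b) e)) *
            (T a * T b * u ^ n (a + b)) := by
          rw [hu', mul_addChar_center_mul, mul_assoc (z _ : G), addChar_center_mul_mul,
            map_add n, zpow_add]
          simp only [mul_assoc]
      _ = _ := by
          rw [hT.map_mul, mul_assoc (z _ : G), addChar_center_mul_mul, addChar_center_mul_mul]
          congr 3
          simp only [LinearMap.compl₁₂_apply, LinearMap.add_apply, LinearMap.smulRight_apply,
            map_add, map_smul, LinearMap.smul_apply, hswap, hB e]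
          module

end IsWeylSystem

section Existence

variable {ι : Type*} [DecidableEq ι]

/-- The projection of the integer vectors onto those supported in `s`. -/
def supportProj (s : Finset ι) : (ι → ℤ) →ₗ[ℤ] ι → ℤ :=
  ∑ i ∈ s, (LinearMap.proj i).smulRight (Pi.single i 1)

lemma supportProj_univ [Fintype ι] : supportProj (Finset.univ : Finset ι) = LinearMap.id :=
  LinearMap.ext fun a => by simp [supportProj, ← Pi.single_smul, Finset.univ_sum_single]

lemma supportProj_insert {s : Finset ι} {k : ι} (hk : k ∉ s) : supportProj (insert k s) =
    supportProj s + (LinearMap.proj k).smulRight (Pi.single k 1) := by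
  rw [add_comm]; exact Finset.sum_insert hk

lemma supportProj_single_of_notMem {s : Finset ι} {k : ι} (hk : k ∉ s) (n : ℤ) :
    supportProj s (Pi.single k n) = 0 := by
  simp only [supportProj, LinearMap.sum_apply, LinearMap.smulRight_apply, LinearMap.proj_apply]
  exact Finset.sum_eq_zero fun j hj => by
    rw [Pi.single_eq_of_ne (by rintro rfl; exact hk hj), zero_smul]

theorem exists_isWeylSystem [Finite ι] {B : LinearMap.BilinMap ℤ (ι → ℤ) Φ} (hB : B.IsAlt)
    {U : ι → G}
    (hU : ∀ i j, U i * U j = z ((2 : ℤ) • B (Pi.single i 1) (Pi.single j 1)) * (U j * U i)) :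
    ∃ T : (ι → ℤ) → G, IsWeylSystem z B T ∧ ∀ i, T (Pi.single i 1) = U i := by
  cases nonempty_fintype ι
  suffices h : ∀ s, ∃ T : (ι → ℤ) → G,
      IsWeylSystem z (B.compl₁₂ (supportProj s) (supportProj s)) T ∧
      (∀ i, T (Pi.single i 1) = if i ∈ s then U i else 1) ∧
      ∀ a l, T a * U l = z ((2 : ℤ) • B (supportProj s a) (Pi.single l 1)) * (U l * T a) by
    obtain ⟨T, hT, hTU, -⟩ := h Finset.univ
    exact ⟨T, by simpa [supportProj_univ] using hT, by simpa using hTU⟩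
  intro s
  induction s using Finset.induction_on with
  | empty => exact ⟨1, ⟨fun _ => hB _, by simp [supportProj]⟩, by simp, by simp [supportProj]⟩
  | insert k s hk ih =>
    obtain ⟨T, hT, hTU, hcomm⟩ := ih
    rw [supportProj_insert hk]
    refine ⟨_, hT.extend hB (fun a => hcomm a k) (LinearMap.proj k), fun i => ?_, fun a l => ?_⟩
    · by_cases hi : i = k
      · simp [hTU, hi, hk, supportProj_single_of_notMem hk]
      · simp [hTU, hi]
    · have hk_comm : U k ^ a k * U l = _ := zpow_mul_eq_of_mul_eq (hU k l) (a k)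
      change z _ * (T a * U k ^ a k) * U l = _ * (U l * (z _ * (T a * U k ^ a k)))
      rw [mul_assoc (z _ : G), mul_assoc (T a), hk_comm, mul_addChar_center_mul, ← mul_assoc (T a),
        hcomm, mul_assoc (z _ : G), mul_addChar_center_mul (U l)]
      simp only [addChar_center_mul_mul, mul_assoc]
      congr 3
      simp only [LinearMap.add_apply, LinearMap.smulRight_apply, map_add, map_smul,
        LinearMap.smul_apply, LinearMap.proj_apply]
      module

end Existence

end Weyl

section Phase

variable (A : Type*) [Ring A] [StarRing A] [Algebra ℂ A] [StarModule ℂ A]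

/-- The scalar unitaries `e^{iπt}`. -/
noncomputable def phase : AddChar ℝ (Subgroup.center (unitary A)) where
  toFun t := ⟨⟨exp (Real.pi * t * I) • 1, by
    have h : star (exp (Real.pi * t * I)) * exp (Real.pi * t * I) = 1 := by
      rw [Complex.star_def, ← Complex.exp_conj, ← Complex.exp_add]
      simp
    rw [Unitary.mem_iff, star_smul, star_one, smul_mul_smul_comm, smul_mul_smul_comm, mul_one,
      mul_comm (exp _), h, one_smul, and_self]⟩,
    Subgroup.mem_center_iff.2 fun g => by ext1; simp⟩
  map_zero_eq_one' := by ext1; ext1; simp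
  map_add_eq_mul' s t := by
    ext1; ext1
    simp only [Complex.ofReal_add, mul_add, add_mul, Complex.exp_add, Submonoid.coe_mul,
      Subgroup.coe_mul, smul_mul_smul_comm, mul_one]

variable {A}

lemma coe_phase (t : ℝ) : ((phase A t : unitary A) : A) = exp (Real.pi * t * I) • 1 := rfl

lemma coe_phase_mul (t : ℝ) (g : unitary A) :
    ((phase A t * g : unitary A) : A) = exp (Real.pi * t * I) • (g : A) := by
  rw [Submonoid.coe_mul, coe_phase, smul_mul_assoc, one_mul]

lemma phase_eq_one {t : ℝ} (n : ℤ) (h : t = 2 * n) : phase A t = 1 := by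
  ext1; ext1
  rw [coe_phase, h, show (Real.pi * ((2 * n : ℝ) : ℂ) * I : ℂ) = n * (2 * Real.pi * I) by
    push_cast; ring, Complex.exp_int_mul_two_pi_mul_I, one_smul]
  rfl

end Phase

section CyclicSums

lemma sum_range_natCast {n : ℕ} [NeZero n] {M : Type*} [AddCommMonoid M] (f : ZMod n → M) :
    ∑ l ∈ Finset.range n, f l = ∑ i, f i :=
  Finset.sum_nbij' (fun l => (l : ZMod n)) ZMod.val (fun _ _ => Finset.mem_univ _)
    (fun i _ => Finset.mem_range.2 (ZMod.val_lt i))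
    (fun _ hl => ZMod.val_cast_of_lt (Finset.mem_range.1 hl)) (fun i _ => ZMod.natCast_zmod_val i)
    fun _ _ => rfl

lemma sum_range_natCast_succ {n : ℕ} [NeZero n] {M : Type*} [AddCommMonoid M] (f : ZMod n → M) :
    ∑ l ∈ Finset.range n, f (l + 1 : ℕ) = ∑ i, f i := by
  simp only [Nat.cast_succ]
  rw [sum_range_natCast fun i => f (i + 1)]
  exact Equiv.sum_comp (Equiv.addRight (1 : ZMod n)) f

lemma sum_range_sum_range_sub {R : Type*} [CommRing R] (f : ℕ → R) (n : ℕ) :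
    ∑ q ∈ Finset.range n, ∑ p ∈ Finset.range q, f (q - p) =
      ∑ j ∈ Finset.Icc 1 (n - 1), ((n : R) - j) * f j := by
  have hreflect (q : ℕ) : ∑ p ∈ Finset.range q, f (q - p) = ∑ j ∈ Finset.Icc 1 q, f j := by
    refine Finset.sum_nbij' (fun p => q - p) (fun j => q - j) ?_ ?_ ?_ ?_ ?_ <;>
      simp only [Finset.mem_range, Finset.mem_Icc, implies_true] <;> lia
  induction n with
  | zero => simp
  | succ n ih =>
    have hlast : ∑ j ∈ Finset.Icc 1 (n - 1), ((n : R) - j) * f j =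
        ∑ j ∈ Finset.Icc 1 n, ((n : R) - j) * f j := by
      refine Finset.sum_subset (Finset.Icc_subset_Icc_right (Nat.sub_le n 1)) fun j hj hj' => ?_
      rw [Finset.mem_Icc] at hj hj'
      rw [show j = n by lia, sub_self, zero_mul]
    rw [Finset.sum_range_succ, ih, hreflect, hlast, Nat.add_sub_cancel, ← Finset.sum_add_distrib]
    exact Finset.sum_congr rfl fun j _ => by push_cast; ring

end CyclicSums

section SiteVectors

variable {N : ℕ}

/-- The vector `n₀ e_i + n₁ e_{i+1} + n₂ e_{i+2}`. -/
def siteTriple (n₀ n₁ n₂ : ℤ) (i : ZMod (2 * N)) : ZMod (2 * N) → ℤ :=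
  Pi.single i n₀ + Pi.single (i + 1) n₁ + Pi.single (i + 2) n₂

/-- The exponents of the relation `U_i^4 U_{i+1}^{-10} U_{i+2}^4 = 𝕀` of the `(1, 9)` theory. -/
def relationVec : ZMod (2 * N) → ZMod (2 * N) → ℤ := siteTriple 4 (-10) 4

/-- The exponents of `K_i`. -/
def clockVec : ZMod (2 * N) → ZMod (2 * N) → ℤ := siteTriple 4 (-2) 0

/-- The exponents of `e^{i φ_L} U_i^2 U_{i+1}^{-5} U_{i+2}^2`. -/
def spinVec : ZMod (2 * N) → ZMod (2 * N) → ℤ := siteTriple 2 (-5) 2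

lemma two_smul_spinVec (i : ZMod (2 * N)) : (2 : ℤ) • spinVec i = relationVec i := by
  simp only [spinVec, relationVec, siteTriple, smul_add, ← Pi.single_smul]
  rfl

lemma clockVec_sub_two_smul (i : ZMod (2 * N)) :
    clockVec i - (2 : ℤ) • clockVec (i + 1) = relationVec i := by
  have htwo : i + 1 + 1 = i + 2 := by ring
  ext k
  simp only [clockVec, relationVec, siteTriple, htwo, Pi.single_zero, Pi.sub_apply, Pi.add_apply,
    Pi.smul_apply, Pi.single_apply, smul_eq_mul]
  split_ifs <;> norm_num

lemma even_clockVec (i k : ZMod (2 * N)) : Even (clockVec i k) := by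
  simp only [clockVec, siteTriple, Pi.add_apply, Pi.single_apply]
  split_ifs <;> decide

lemma even_spinVec [NeZero N] {i k : ZMod (2 * N)} (h : siteSign k = siteSign i) :
    Even (spinVec i k) := by
  have hne : k ≠ i + 1 := by
    rintro rfl
    rw [siteSign_add_one, neg_eq_self] at h
    simpa [h] using siteSign_mul_self i
  simp only [spinVec, siteTriple, Pi.add_apply, Pi.single_apply, if_neg hne]
  split_ifs <;> decide

end SiteVectors

section Pairing

variable {N : ℕ} [NeZero N]

/-- The bilinear form of `𝒵⁻¹` on the integer vectors indexed by the impurities. -/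
noncomputable def pairing (k₁ k₂ N : ℕ) [NeZero N] :
    LinearMap.BilinMap ℤ (ZMod (2 * N) → ℤ) ℝ :=
  Matrix.toLinearMap₂' ℤ (Matrix.of (zInv k₁ k₂ N))

section

variable {k₁ k₂ : ℕ}

lemma pairing_apply (a b : ZMod (2 * N) → ℤ) :
    pairing k₁ k₂ N a b = ∑ i, ∑ j, (a i : ℝ) * (b j * zInv k₁ k₂ N i j) := by
  simp only [pairing, Matrix.toLinearMap₂'_apply, Matrix.of_apply, zsmul_eq_mul]

lemma pairing_single_single (i j : ZMod (2 * N)) (m n : ℤ) :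
    pairing k₁ k₂ N (Pi.single i m) (Pi.single j n) = m * n * zInv k₁ k₂ N i j := by
  rw [pairing_apply, Finset.sum_eq_single i (fun k _ hk => by simp [hk]) (by simp),
    Finset.sum_eq_single j (fun k _ hk => by simp [hk]) (by simp), Pi.single_eq_same,
    Pi.single_eq_same, mul_assoc]

lemma pairing_isAlt [NeZero k₁] [NeZero k₂] : (pairing k₁ k₂ N).IsAlt := fun a => by
  refine self_eq_neg.1 ?_
  simp only [pairing_apply, ← Finset.sum_neg_distrib]
  rw [Finset.sum_comm]
  exact Finset.sum_congr rfl fun i _ => Finset.sum_congr rfl fun j _ => by rw [zInv_skew]; ring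

end

lemma pairing_relationVec (i : ZMod (2 * N)) (b : ZMod (2 * N) → ℤ) :
    pairing 1 9 N (relationVec i) b = b i - b (i + 2) := by
  have hsingle (n : ℤ) (i : ZMod (2 * N)) :
      pairing 1 9 N (Pi.single i n) b = ∑ j, n * zInv 1 9 N i j * b j := by
    conv_lhs => rw [← Finset.univ_sum_single b, map_sum]
    exact Finset.sum_congr rfl fun j _ => by rw [pairing_single_single]; ring
  have hrec (j : ZMod (2 * N)) := zInv_recurrence 1 9 i j
  calc pairing 1 9 N (relationVec i) b
      = ∑ j, ((if i = j then 1 else 0) - if i + 2 = j then 1 else 0) * (b j : ℝ) := by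
        rw [relationVec, siteTriple, map_add, map_add, LinearMap.add_apply, LinearMap.add_apply,
          hsingle, hsingle, hsingle, ← Finset.sum_add_distrib, ← Finset.sum_add_distrib]
        exact Finset.sum_congr rfl fun j _ => by
          rw [← hrec]; push_cast; ring
    _ = b i - b (i + 2) := by simp [sub_mul]

lemma pairing_spinVec (i : ZMod (2 * N)) (b : ZMod (2 * N) → ℤ) :
    2 * pairing 1 9 N (spinVec i) b = b i - b (i + 2) := by
  rw [← pairing_relationVec, ← two_smul_spinVec, map_smul, LinearMap.smul_apply, zsmul_eq_mul]
  norm_num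

lemma pairing_clockVec_sub (i : ZMod (2 * N)) (b : ZMod (2 * N) → ℤ) :
    pairing 1 9 N (clockVec i) b - 2 * pairing 1 9 N (clockVec (i + 1)) b = b i - b (i + 2) := by
  rw [← pairing_relationVec, ← clockVec_sub_two_smul, map_sub, map_smul, LinearMap.sub_apply,
    LinearMap.smul_apply, zsmul_eq_mul]
  norm_num

lemma pairing_clockVec_clockVec (i j : ZMod (2 * N)) :
    pairing 1 9 N (clockVec i) (clockVec j) =
      2 * ((if i + 1 = j then 1 else 0) - if i - 1 = j then 1 else 0) := by
  have hrec := zInv_recurrence 1 9 (i - 1) j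
  have hshift : zInv 1 9 N i (j + 1) = zInv 1 9 N (i - 1) j := by
    rw [← zInv_add_one_add_one 1 9 (i - 1), sub_add_cancel]
  rw [sub_add_cancel, show i - 1 + 2 = i + 1 by ring] at hrec
  simp only [clockVec, siteTriple, Pi.single_zero, add_zero, map_add, LinearMap.add_apply,
    pairing_single_single, zInv_add_one_add_one, hshift]
  push_cast at hrec ⊢
  linear_combination (-2) * hrec

lemma exists_pairing_clockVec_clockVec (i j : ZMod (2 * N)) :
    ∃ n : ℤ, pairing 1 9 N (clockVec i) (clockVec j) = 2 * n :=
  ⟨(if i + 1 = j then 1 else 0) - if i - 1 = j then 1 else 0, by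
    rw [pairing_clockVec_clockVec]; push_cast; rfl⟩

end Pairing

section Gauge

lemma exp_smul_coe {A : Type*} [Ring A] [StarRing A] [Algebra ℂ A] [StarModule ℂ A] (θ : ℝ)
    (u : unitary A) : exp (I * θ) • (u : A) = (phase A (θ / Real.pi) * u : unitary A) := by
  have hpi : (Real.pi : ℂ) ≠ 0 := Complex.ofReal_ne_zero.2 Real.pi_ne_zero
  rw [coe_phase_mul]
  congr 2
  push_cast
  field_simp

lemma pairing_single_of_eq_units_pow {k₁ k₂ N : ℕ} [NeZero k₁] [NeZero k₂] [NeZero N]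
    {ε : ℤˣ} {b : ZMod (2 * N) → ℤ} (hb : ∀ n : ℕ, b n = (ε ^ n : ℤˣ)) {p q : ℕ} (hpq : p < q) :
    pairing k₁ k₂ N (Pi.single p (b p)) (Pi.single q (b q)) =
      ((ε ^ (q - p) : ℤˣ) : ℤ) * zInvRel k₁ k₂ N ((q - p : ℕ) : ZMod (2 * N)) := by
  have hε : ε ^ p * ε ^ q = ε ^ (q - p) := by
    rw [← pow_add, show p + q = q - p + 2 * p by lia, pow_add, pow_mul, Int.units_sq, one_pow,
      mul_one]
  rw [pairing_single_single, hb, hb, ← Int.cast_mul, ← Units.val_mul, hε, zInv_eq_zInvRel,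
    Nat.cast_sub hpq.le]

namespace EdgeTheory

section

variable {k₁ k₂ N : ℕ} [NeZero k₁] [NeZero k₂] [NeZero N] {V : Type*} [NormedAddCommGroup V]
  [InnerProductSpace ℂ V] [FiniteDimensional ℂ V] (𝓔 : EdgeTheory k₁ k₂ N V)

lemma exists_weyl : ∃ T, IsWeylSystem (phase (Module.End ℂ V)) (pairing k₁ k₂ N) T ∧
    ∀ i, T (Pi.single i 1) =
      phase (Module.End ℂ V) (-(phaseU k₁ k₂ N / Real.pi)) * 𝓔.U i := by
  refine exists_isWeylSystem pairing_isAlt fun i j => ?_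
  have hU : 𝓔.U i * 𝓔.U j =
      phase (Module.End ℂ V) ((2 : ℤ) • zInv k₁ k₂ N i j) * (𝓔.U j * 𝓔.U i) := by
    ext1
    rw [coe_phase_mul, Submonoid.coe_mul, Submonoid.coe_mul, 𝓔.U_mul_U]
    congr 2
    push_cast [zsmul_eq_mul]
    ring
  rw [pairing_single_single, Int.cast_one, one_mul, one_mul]
  rw [addChar_center_mul_mul_mul, addChar_center_mul_mul_mul, hU, addChar_center_mul_mul,
    addChar_center_mul_mul, add_comm]

/-- The Weyl operators `e^{i a · Γ}` of an edge theory, where `U_i = e^{i Γ_i + i φ}`. -/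
noncomputable def weyl : (ZMod (2 * N) → ℤ) → unitary (Module.End ℂ V) := 𝓔.exists_weyl.choose

lemma isWeylSystem_weyl : IsWeylSystem (phase (Module.End ℂ V)) (pairing k₁ k₂ N) 𝓔.weyl :=
  𝓔.exists_weyl.choose_spec.1

lemma U_zpow (i : ZMod (2 * N)) (n : ℤ) : 𝓔.U i ^ n =
    phase (Module.End ℂ V) (n * (phaseU k₁ k₂ N / Real.pi)) * 𝓔.weyl (Pi.single i n) := by
  have hU : 𝓔.U i = phase (Module.End ℂ V) (phaseU k₁ k₂ N / Real.pi) *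
      𝓔.weyl (Pi.single i 1) := by
    simpa only [neg_neg, weyl] using eq_addChar_center_neg_mul (𝓔.exists_weyl.choose_spec.2 i)
  have hcomm : Commute (phase (Module.End ℂ V) (phaseU k₁ k₂ N / Real.pi) :
      unitary (Module.End ℂ V)) (𝓔.weyl (Pi.single i 1)) := (mul_addChar_center _ _).symm
  rw [hU, hcomm.mul_zpow, ← 𝓔.isWeylSystem_weyl.map_zsmul, ← Subgroup.coe_zpow,
    ← AddChar.map_zsmul_eq_zpow, zsmul_eq_mul, ← Pi.single_smul, smul_eq_mul, mul_one]

lemma U_zpow_mul_U_zpow_mul_U_zpow (i : ZMod (2 * N)) (n₀ n₁ n₂ : ℤ) :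
    𝓔.U i ^ n₀ * 𝓔.U (i + 1) ^ n₁ * 𝓔.U (i + 2) ^ n₂ =
      phase (Module.End ℂ V) ((n₀ + n₁ + n₂) * (phaseU k₁ k₂ N / Real.pi) +
        (n₀ * n₁ + n₁ * n₂) * zInvRel k₁ k₂ N 1 + n₀ * n₂ * zInvRel k₁ k₂ N 2) *
        𝓔.weyl (siteTriple n₀ n₁ n₂ i) := by
  have hone : i + 2 - (i + 1) = 1 := by ring
  rw [U_zpow, U_zpow, U_zpow, addChar_center_mul_mul_mul, 𝓔.isWeylSystem_weyl.map_mul,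
    addChar_center_mul_mul, addChar_center_mul_mul_mul, 𝓔.isWeylSystem_weyl.map_mul,
    addChar_center_mul_mul, siteTriple]
  simp only [map_add, LinearMap.add_apply, pairing_single_single, zInv_eq_zInvRel,
    add_sub_cancel_left, hone]
  congr 3
  ring

lemma weyl_eq_one_of_prod_U_zpow {ε : ℤˣ} {b : ZMod (2 * N) → ℤ}
    (hb : ∀ n : ℕ, b n = (ε ^ n : ℤˣ)) {θ : ℝ}
    (hprod : (((List.range (2 * N)).map fun l : ℕ =>
      𝓔.U ((l + 1 : ℕ) : ZMod (2 * N)) ^ b ((l + 1 : ℕ) : ZMod (2 * N))).prod :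
        Module.End ℂ V) = exp (I * θ) • 1)
    (hθ : θ = Real.pi * ∑ j ∈ Finset.Icc 1 (2 * N - 1),
      (2 * (N : ℝ) - j) * ((ε ^ j : ℤˣ) : ℤ) * zInvRel k₁ k₂ N (j : ZMod (2 * N)) +
        (∑ i, b i : ℤ) * phaseU k₁ k₂ N) :
    𝓔.weyl b = 1 := by
  have hθ' : θ / Real.pi =
      ∑ l ∈ Finset.range (2 * N), (b (l + 1 : ℕ) : ℝ) * (phaseU k₁ k₂ N / Real.pi) +
        ∑ q ∈ Finset.range (2 * N), ∑ p ∈ Finset.range q,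
          pairing k₁ k₂ N (Pi.single (p + 1 : ℕ) (b (p + 1 : ℕ)))
            (Pi.single (q + 1 : ℕ) (b (q + 1 : ℕ))) := by
    have hpi := Real.pi_ne_zero
    have hsum := sum_range_sum_range_sub (fun j => ((ε ^ j : ℤˣ) : ℤ) *
      zInvRel k₁ k₂ N (j : ZMod (2 * N))) (2 * N)
    rw [Finset.sum_congr rfl fun q _ => Finset.sum_congr rfl fun p hp => by
      rw [pairing_single_of_eq_units_pow hb (Nat.add_lt_add_right (Finset.mem_range.1 hp) 1),
        Nat.add_sub_add_right], hsum, ← Finset.sum_mul,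
      sum_range_natCast_succ fun i => (b i : ℝ), hθ]
    push_cast
    simp only [mul_assoc]
    field_simp
    ring
  have hprod' : ((List.range (2 * N)).map fun l : ℕ =>
      𝓔.U ((l + 1 : ℕ) : ZMod (2 * N)) ^ b ((l + 1 : ℕ) : ZMod (2 * N))).prod =
        phase (Module.End ℂ V) (θ / Real.pi) * 1 := by
    ext1
    rw [hprod, ← exp_smul_coe]
    rfl
  simp only [U_zpow] at hprod'
  rw [prod_range_addChar_center_mul, 𝓔.isWeylSystem_weyl.prod_range, addChar_center_mul_mul,
    ← hθ', sum_range_natCast_succ fun i => Pi.single i (b i), Finset.univ_sum_single] at hprod'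
  exact mul_left_cancel hprod'

lemma weyl_one : 𝓔.weyl 1 = 1 :=
  𝓔.weyl_eq_one_of_prod_U_zpow (ε := 1) (θ := theta₁ k₁ k₂ N) (by simp)
    (by simpa using 𝓔.prod_U) (by simp [theta₁])

lemma weyl_siteSign : 𝓔.weyl siteSign = 1 :=
  𝓔.weyl_eq_one_of_prod_U_zpow (ε := -1) (θ := theta₂ k₁ k₂ N) (by simp [siteSign_natCast])
    (by simpa only [siteSign_natCast] using 𝓔.prod_U_alternating) (by simp [theta₂, sum_siteSign])

end

section

variable {N : ℕ} [NeZero N] {V : Type*} [NormedAddCommGroup V] [InnerProductSpace ℂ V]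
  [FiniteDimensional ℂ V] (𝓔 : EdgeTheory 1 9 N V)

lemma phaseU_div_pi : phaseU 1 9 N / Real.pi =
    8 * zInvRel 1 9 N 2 - 40 * zInvRel 1 9 N 1 + 2 := by
  have hpi := Real.pi_ne_zero
  rw [phaseU]
  field_simp
  norm_num
  ring

lemma weyl_relationVec (i : ZMod (2 * N)) : 𝓔.weyl (relationVec i) = 1 := by
  have h := 𝓔.U_relation i
  rw [show (((9 : ℕ) : ℤ) - (1 : ℕ)) / 2 = 4 by norm_num,
    show -(((1 : ℕ) : ℤ) + (9 : ℕ)) = -10 by norm_num,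
    𝓔.U_zpow_mul_U_zpow_mul_U_zpow, phaseU_div_pi, phase_eq_one (-2) (by push_cast; ring)] at h
  simpa [relationVec] using h

lemma K_eq (i : ZMod (2 * N)) : 𝓔.K i = (𝓔.weyl (clockVec i) : Module.End ℂ V) := by
  have hU := 𝓔.U_zpow_mul_U_zpow_mul_U_zpow i 4 (-2) 0
  have hrec := zInvRel_recurrence (N := N) 1 9
  push_cast at hrec
  rw [zpow_zero, mul_one] at hU
  rw [K, exp_smul_coe, hU, addChar_center_mul_mul, phaseU_div_pi, phaseK,
    phase_eq_one (if (2 : ZMod (2 * N)) = 0 then 2 else 0), Subgroup.coe_one, one_mul, clockVec]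
  field_simp
  push_cast
  split_ifs at hrec ⊢ <;> linear_combination 4 * hrec

lemma L_eq (j : Fin N) : 𝓔.L j =
    (𝓔.weyl (spinVec ((2 * (j : ℕ) + 1 : ℕ) : ZMod (2 * N))) : Module.End ℂ V) := by
  have hpi := Real.pi_ne_zero
  have hsite₁ : ((2 * (j : ℕ) + 2 : ℕ) : ZMod (2 * N)) = (2 * (j : ℕ) + 1 : ℕ) + 1 := by
    push_cast; ring
  have hsite₂ : ((2 * (j : ℕ) + 3 : ℕ) : ZMod (2 * N)) = (2 * (j : ℕ) + 1 : ℕ) + 2 := by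
    push_cast; ring
  rw [L, exp_smul_coe, hsite₁, hsite₂, 𝓔.U_zpow_mul_U_zpow_mul_U_zpow, addChar_center_mul_mul,
    phaseU_div_pi, phaseL, phase_eq_one (-1), Subgroup.coe_one, one_mul, spinVec]
  field_simp
  push_cast
  ring

end

end EdgeTheory

end Gauge

section ClockOrder

lemma three_mul_clockOrder_add_one (N : ℕ) : 3 * clockOrder N + 1 = 4 ^ N := by
  have hmod : 4 ^ N % 3 = 1 := by rw [Nat.pow_mod]; simp
  rw [clockOrder]
  lia

lemma three_mul_clockOrder (N : ℕ) : 3 * clockOrder N = 4 ^ N - 1 :=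
  eq_tsub_of_add_eq (three_mul_clockOrder_add_one N)

lemma clockOrder_pos (N : ℕ) [NeZero N] : 0 < clockOrder N := by
  have hpow : 4 ^ 1 ≤ 4 ^ N := Nat.pow_le_pow_right (by norm_num) (Nat.pos_of_ne_zero (NeZero.ne N))
  have hclock := three_mul_clockOrder_add_one N
  lia

lemma sum_neg_two_pow (N : ℕ) : ∑ n ∈ Finset.range (2 * N), (-2 : ℤ) ^ n = -clockOrder N := by
  have hgeom := geom_sum_mul (-2 : ℤ) (2 * N)
  have hclock : (3 * clockOrder N + 1 : ℤ) = 4 ^ N := mod_cast three_mul_clockOrder_add_one N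
  rw [pow_mul, neg_sq, show (2 : ℤ) ^ 2 = 4 by norm_num] at hgeom
  linarith

end ClockOrder

lemma prod_range_zpow {G : Type*} [Group G] (x : G) (a : ℕ → ℤ) (n : ℕ) :
    ((List.range n).map fun l => x ^ a l).prod = x ^ ∑ l ∈ Finset.range n, a l := by
  induction n with
  | zero => simp
  | succ n ih =>
    rw [List.range_succ, List.map_append, List.prod_append, ih, List.map_singleton,
      List.prod_singleton, Finset.sum_range_succ, zpow_add]

section Clock

variable {N : ℕ} [NeZero N]

lemma sum_siteSign_smul_clockVec :
    ∑ n ∈ Finset.range (2 * N), siteSign (n : ZMod (2 * N)) • clockVec (-(n : ZMod (2 * N))) =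
      (6 : ℤ) • siteSign := by
  have hterm (i : ZMod (2 * N)) : siteSign (-i) • clockVec (- -i) =
      Pi.single i (4 * siteSign i) + Pi.single (i + 1) (2 * siteSign (i + 1)) := by
    rw [siteSign_neg, neg_neg, clockVec, siteTriple, Pi.single_zero, add_zero, siteSign_add_one,
      smul_add, ← Pi.single_smul, ← Pi.single_smul]
    congr 2 <;> simp only [smul_eq_mul] <;> ring
  have hshift := Equiv.sum_comp (Equiv.addRight (1 : ZMod (2 * N)))
    fun i => (Pi.single i (2 * siteSign i) : ZMod (2 * N) → ℤ)
  simp only [Equiv.coe_addRight] at hshift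
  rw [sum_range_natCast fun i => siteSign i • clockVec (-i),
    ← Equiv.sum_comp (Equiv.neg (ZMod (2 * N)))]
  simp only [Equiv.neg_apply, hterm, Finset.sum_add_distrib]
  rw [hshift, Finset.univ_sum_single, Finset.univ_sum_single]
  ext i
  simp only [Pi.add_apply, Pi.smul_apply, smul_eq_mul]
  ring

variable {V : Type*} [NormedAddCommGroup V] [InnerProductSpace ℂ V] [FiniteDimensional ℂ V]

namespace EdgeTheory

variable (𝓔 : EdgeTheory 1 9 N V)

/-- The unitary `K_i`. -/
noncomputable def clock (i : ZMod (2 * N)) : unitary (Module.End ℂ V) := 𝓔.weyl (clockVec i)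

/-- The unitary `e^{i φ_L} U_i^2 U_{i+1}^{-5} U_{i+2}^2`. -/
noncomputable def spin (i : ZMod (2 * N)) : unitary (Module.End ℂ V) := 𝓔.weyl (spinVec i)

lemma clock_commute (i j : ZMod (2 * N)) : Commute (𝓔.clock i) (𝓔.clock j) := by
  obtain ⟨n, hn⟩ := exists_pairing_clockVec_clockVec i j
  exact 𝓔.isWeylSystem_weyl.commute (phase_eq_one (2 * n) (by
    rw [hn, zsmul_eq_mul]; push_cast; ring))

lemma spin_commute_weyl {i : ZMod (2 * N)} {b : ZMod (2 * N) → ℤ} (h : Even (b i - b (i + 2))) :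
    Commute (𝓔.spin i) (𝓔.weyl b) := by
  obtain ⟨n, hn⟩ := h
  refine 𝓔.isWeylSystem_weyl.commute (phase_eq_one n ?_)
  rw [zsmul_eq_mul, Int.cast_ofNat, pairing_spinVec, ← Int.cast_sub, hn, ← two_mul]
  push_cast
  rfl

lemma spin_commute_clock (i j : ZMod (2 * N)) : Commute (𝓔.spin i) (𝓔.clock j) :=
  𝓔.spin_commute_weyl ((even_clockVec j i).sub (even_clockVec j (i + 2)))

lemma spin_commute_spin {i j : ZMod (2 * N)} (h : siteSign i = siteSign j) :
    Commute (𝓔.spin i) (𝓔.spin j) :=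
  𝓔.spin_commute_weyl ((even_spinVec h).sub (even_spinVec (by rw [siteSign_add_two, h])))

lemma spin_sq (i : ZMod (2 * N)) : 𝓔.spin i ^ 2 = 1 := by
  rw [spin, ← zpow_ofNat, ← 𝓔.isWeylSystem_weyl.map_zsmul, two_smul_spinVec, weyl_relationVec]

lemma clock_sq (i : ZMod (2 * N)) : 𝓔.clock i ^ 2 = 𝓔.clock (i - 1) := by
  obtain ⟨n, hn⟩ := (even_clockVec i (i - 1)).sub (even_clockVec i (i - 1 + 2))
  have hvec : relationVec (i - 1) + (2 : ℤ) • clockVec i = clockVec (i - 1) := by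
    rw [← clockVec_sub_two_smul, sub_add_cancel, sub_add_cancel]
  have hphase : phase (Module.End ℂ V)
      (pairing 1 9 N (relationVec (i - 1)) ((2 : ℤ) • clockVec i)) = 1 := by
    refine phase_eq_one (2 * n) ?_
    rw [pairing_relationVec, Pi.smul_apply, Pi.smul_apply, ← Int.cast_sub, ← smul_sub, hn,
      smul_eq_mul]
    push_cast
    ring
  have hmul := 𝓔.isWeylSystem_weyl.map_mul (relationVec (i - 1)) ((2 : ℤ) • clockVec i)
  rwa [hphase, hvec, weyl_relationVec, one_mul, Subgroup.coe_one, one_mul,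
    𝓔.isWeylSystem_weyl.map_zsmul, zpow_ofNat] at hmul

lemma clock_neg (n : ℕ) : 𝓔.clock (-(n : ZMod (2 * N))) = 𝓔.clock 0 ^ (2 ^ n) := by
  induction n with
  | zero => simp
  | succ n ih => rw [Nat.cast_succ, neg_add, ← sub_eq_add_neg, ← clock_sq, ih, ← pow_mul, pow_succ]

lemma weyl_siteSign_smul_clockVec (n : ℕ) :
    𝓔.weyl (siteSign (n : ZMod (2 * N)) • clockVec (-(n : ZMod (2 * N)))) =
      𝓔.clock 0 ^ ((-2 : ℤ) ^ n) := by
  rw [𝓔.isWeylSystem_weyl.map_zsmul, ← clock, clock_neg, siteSign_natCast, ← zpow_natCast,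
    ← zpow_mul, Nat.cast_pow, ← mul_pow]
  norm_num

lemma clock_pow_clockOrder : 𝓔.clock 0 ^ clockOrder N = 1 := by
  have hprod := 𝓔.isWeylSystem_weyl.prod_range
    (fun n => siteSign (n : ZMod (2 * N)) • clockVec (-(n : ZMod (2 * N)))) (2 * N)
  have hphase : phase (Module.End ℂ V) (∑ q ∈ Finset.range (2 * N), ∑ p ∈ Finset.range q,
      pairing 1 9 N (siteSign (p : ZMod (2 * N)) • clockVec (-(p : ZMod (2 * N))))
        (siteSign (q : ZMod (2 * N)) • clockVec (-(q : ZMod (2 * N))))) = 1 := by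
    choose n hn using exists_pairing_clockVec_clockVec (N := N)
    refine phase_eq_one (∑ q ∈ Finset.range (2 * N), ∑ p ∈ Finset.range q,
      siteSign (p : ZMod (2 * N)) * siteSign (q : ZMod (2 * N)) * n (-p) (-q)) ?_
    simp only [LinearMap.map_smul_of_tower, LinearMap.smul_apply, hn]
    push_cast [Finset.mul_sum, zsmul_eq_mul]
    exact Finset.sum_congr rfl fun q _ => Finset.sum_congr rfl fun p _ => by ring
  simp only [weyl_siteSign_smul_clockVec] at hprod
  rw [hphase, sum_siteSign_smul_clockVec, 𝓔.isWeylSystem_weyl.map_zsmul, weyl_siteSign, one_zpow,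
    Subgroup.coe_one, one_mul, prod_range_zpow, sum_neg_two_pow, zpow_neg, inv_eq_one,
    zpow_natCast] at hprod
  exact hprod

end EdgeTheory

end Clock

section ClockWeights

variable {N : ℕ} [NeZero N]

lemma pairing_clockVec_zero_single_add_one (j : ZMod (2 * N)) :
    pairing 1 9 N (clockVec 0) (Pi.single (j + 1) 1) =
      2 * pairing 1 9 N (clockVec 0) (Pi.single j 1) +
        ((if j = -1 then 1 else 0) - if j = 1 then 1 else 0) := by
  have hshift : pairing 1 9 N (clockVec 0) (Pi.single (j + 1) 1) =
      pairing 1 9 N (clockVec (-1)) (Pi.single j 1) := by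
    have hzero := zInv_add_one_add_one 1 9 (-1) j
    have hone := zInv_add_one_add_one 1 9 0 j
    rw [neg_add_cancel] at hzero
    rw [zero_add] at hone
    simp [clockVec, siteTriple, pairing_single_single, hzero, hone]
  have hstep := pairing_clockVec_sub (-1 : ZMod (2 * N)) (Pi.single j 1)
  simp only [neg_add_cancel, show (-1 + 2 : ZMod (2 * N)) = 1 by ring, Pi.single_apply,
    eq_comm (b := j)] at hstep
  rw [hshift]
  push_cast at hstep
  linear_combination hstep

lemma eq_zero_of_add_one_eq_two_mul {f : ZMod (2 * N) → ℝ} (h : ∀ j, f (j + 1) = 2 * f j) :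
    f = 0 := by
  have hpow (j : ZMod (2 * N)) (n : ℕ) : f (j + n) = 2 ^ n * f j := by
    induction n with
    | zero => simp
    | succ n ih => rw [Nat.cast_succ, ← add_assoc, h, ih, pow_succ]; ring
  ext j
  have hperiod := hpow j (2 * N)
  rw [ZMod.natCast_self, add_zero, eq_comm, mul_left_eq_self₀] at hperiod
  exact hperiod.resolve_left (one_lt_pow₀ one_lt_two (NeZero.ne _)).ne'

lemma siteLabel_eq_two_mul_iff {j : ZMod (2 * N)} : siteLabel N j = 2 * N ↔ j = 0 :=
  ⟨fun h => siteLabel_injective (h.trans siteLabel_zero.symm), fun h => h ▸ siteLabel_zero⟩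

lemma two_pow_siteLabel_add_one (j : ZMod (2 * N)) : (2 : ℝ) ^ siteLabel N (j + 1) =
    2 * 2 ^ siteLabel N j - if j = 0 then 2 * (4 ^ N - 1) else 0 := by
  simp only [siteLabel_add_one, siteLabel_eq_two_mul_iff]
  split_ifs with hj
  · rw [hj, siteLabel_zero, pow_mul]
    norm_num
    ring
  · rw [pow_succ]
    ring

lemma pairing_clockVec_zero_single (j : ZMod (2 * N)) :
    2 * (4 ^ N - 1) * pairing 1 9 N (clockVec 0) (Pi.single j 1) =
      2 ^ siteLabel N (j - 1) - 2 ^ siteLabel N (j + 1) := by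
  refine sub_eq_zero.1 (congrFun (eq_zero_of_add_one_eq_two_mul fun j => ?_ :
    (fun j => 2 * (4 ^ N - 1) * pairing 1 9 N (clockVec 0) (Pi.single j 1) -
      (2 ^ siteLabel N (j - 1) - 2 ^ siteLabel N (j + 1) : ℝ)) = 0) j)
  have hpred := two_pow_siteLabel_add_one (j - 1)
  have hsucc := two_pow_siteLabel_add_one (j + 1)
  simp only [sub_add_cancel, sub_eq_zero] at hpred
  simp only [← eq_neg_iff_add_eq_zero] at hsucc
  rw [pairing_clockVec_zero_single_add_one, add_sub_cancel_right, hpred, hsucc]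
  split_ifs <;> ring

lemma pairing_clockVec_zero_single_two (hN : 2 ≤ N) :
    pairing 1 9 N (clockVec 0) (Pi.single 2 1) * clockOrder N = -1 := by
  have hclock : (3 * clockOrder N + 1 : ℝ) = 4 ^ N := mod_cast three_mul_clockOrder_add_one N
  have hone : siteLabel N (2 - 1) = 1 := by
    rw [siteLabel, show (2 - 1 - 1 : ZMod (2 * N)) = 0 by ring, ZMod.val_zero]
  have hthree : siteLabel N (2 + 1) = 3 := by
    rw [siteLabel, add_sub_cancel_right, ZMod.val_ofNat_of_lt (by lia)]
  have hpairing := pairing_clockVec_zero_single (2 : ZMod (2 * N))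
  rw [hone, hthree, ← hclock] at hpairing
  linarith

end ClockWeights

section Multiplicity

variable {V : Type*} [AddCommGroup V] [Module ℂ V]

lemma card_mul_finrank_invariants [FiniteDimensional ℂ V] {Γ : Type*} [Group Γ]
    [Fintype Γ] (ρ : Representation ℂ Γ V)
    (h : ∀ g ≠ 1, LinearMap.trace ℂ V (ρ g) = 0) :
    Fintype.card Γ * Module.finrank ℂ ρ.invariants = Module.finrank ℂ V := by
  have hcard : (Fintype.card Γ : ℂ) ≠ 0 := Nat.cast_ne_zero.2 Fintype.card_ne_zero
  let _ : Invertible (Fintype.card Γ : ℂ) := invertibleOfNonzero hcard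
  have haverage : ρ.averageMap = (Fintype.card Γ : ℂ)⁻¹ • ∑ g, ρ g := by
    simp [Representation.averageMap, GroupAlgebra.average, map_sum]
  have htrace := (Representation.isProj_averageMap ρ).trace
  rw [haverage, map_smul, map_sum, Finset.sum_eq_single 1 (fun g _ hg => h g hg) (by simp), map_one,
    LinearMap.trace_one, smul_eq_mul, inv_mul_eq_iff_eq_mul₀ hcard] at htrace
  exact_mod_cast htrace.symm

variable {G : Type*} [Group G]

/-- The homomorphism `k ↦ x ^ k` from `ℤ/n` to a group in which `x ^ n = 1`. -/
def zmodPowHom {n : ℕ} (x : G) (hx : x ^ n = 1) : Multiplicative (ZMod n) →* G :=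
  AddMonoidHom.toMultiplicativeLeft (ZMod.lift n ⟨zmultiplesHom (Additive G) (Additive.ofMul x), by
    simpa using congrArg Additive.ofMul hx⟩)

lemma zmodPowHom_ofAdd_natCast {n : ℕ} (x : G) (hx : x ^ n = 1) (k : ℕ) :
    zmodPowHom x hx (Multiplicative.ofAdd (k : ZMod n)) = x ^ k := by
  simp [zmodPowHom, ← Int.cast_natCast (R := ZMod n), -Int.cast_natCast]

lemma zmodPowHom_apply {n : ℕ} [NeZero n] (x : G) (hx : x ^ n = 1) (k : Multiplicative (ZMod n)) :
    zmodPowHom x hx k = x ^ k.toAdd.val := by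
  rw [← zmodPowHom_ofAdd_natCast x hx, ZMod.natCast_zmod_val, ofAdd_toAdd]

/-- The representation `(g, c) ↦ c⁻¹ ρ(g)`: its fixed vectors are eigenvectors of `ρ`. -/
def twistedRep (ρ : Representation ℂ G V) : Representation ℂ (G × ℂˣ) V where
  toFun g := ((g.2⁻¹ : ℂˣ) : ℂ) • ρ g.1
  map_one' := by simp
  map_mul' g h := by
    rw [smul_mul_smul_comm, Prod.snd_mul, mul_inv, Units.val_mul, Prod.fst_mul, map_mul]

lemma twistedRep_apply (ρ : Representation ℂ G V) (g : G × ℂˣ) :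
    twistedRep ρ g = ((g.2⁻¹ : ℂˣ) : ℂ) • ρ g.1 := rfl

lemma twistedRep_apply_eq_self_iff (ρ : Representation ℂ G V) (g : G) (c : ℂˣ) (v : V) :
    twistedRep ρ (g, c) v = v ↔ v ∈ Module.End.eigenspace (ρ g) (c : ℂ) := by
  rw [Module.End.mem_eigenspace_iff, twistedRep_apply, LinearMap.smul_apply,
    Units.val_inv_eq_inv_val, inv_smul_eq_iff₀ c.ne_zero]

variable {ι : Type*} {x : ι → G} {n : ι → ℕ} [∀ i, NeZero (n i)]

lemma pairwise_commute_zmodPowHom (hx : Pairwise fun i j => Commute (x i) (x j))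
    (hpow : ∀ i, x i ^ n i = 1) : Pairwise fun i j => ∀ k l,
      Commute (zmodPowHom (x i) (hpow i) k) (zmodPowHom (x j) (hpow j) l) := fun i j hij k l => by
  rw [zmodPowHom_apply, zmodPowHom_apply]
  exact (hx hij).pow_pow _ _

variable [Fintype ι]

/-- The homomorphism `k ↦ ∏ i, x i ^ k i` given by commuting elements of finite orders. -/
def prodPowHom (hx : Pairwise fun i j => Commute (x i) (x j)) (hpow : ∀ i, x i ^ n i = 1) :
    (∀ i, Multiplicative (ZMod (n i))) →* G :=
  MonoidHom.noncommPiCoprod (fun i => zmodPowHom (x i) (hpow i))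
    (pairwise_commute_zmodPowHom hx hpow)

lemma prodPowHom_apply (hx : Pairwise fun i j => Commute (x i) (x j)) (hpow : ∀ i, x i ^ n i = 1)
    (k : ∀ i, Multiplicative (ZMod (n i))) : prodPowHom hx hpow k =
      Finset.univ.noncommProd (fun i => x i ^ (k i).toAdd.val)
        fun _ _ _ _ hij => (hx hij).pow_pow _ _ := by
  simp only [prodPowHom, MonoidHom.noncommPiCoprod, MonoidHom.coe_mk, OneHom.coe_mk,
    zmodPowHom_apply]

lemma mem_invariants_comp_prodPowHom_iff (ρ : Representation ℂ G V)
    (hx : Pairwise fun i j => Commute (x i) (x j)) (hpow : ∀ i, x i ^ n i = 1) (v : V) :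
    v ∈ Representation.invariants (ρ.comp (prodPowHom hx hpow)) ↔ ∀ i, ρ (x i) v = v := by
  classical
  rw [Representation.mem_invariants]
  constructor
  · intro h i
    have hgen : prodPowHom hx hpow (Pi.mulSingle i (Multiplicative.ofAdd ((1 : ℕ) : ZMod (n i)))) =
        x i := by
      rw [prodPowHom, MonoidHom.noncommPiCoprod_mulSingle, zmodPowHom_ofAdd_natCast, pow_one]
    have hfix := h (Pi.mulSingle i (Multiplicative.ofAdd ((1 : ℕ) : ZMod (n i))))
    rwa [MonoidHom.comp_apply, hgen] at hfix
  · intro h k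
    rw [MonoidHom.comp_apply, prodPowHom_apply]
    exact Submonoid.noncommProd_mem ((MulAction.stabilizerSubmonoid (Module.End ℂ V) v).comap ρ)
      _ _ _ fun i _ => pow_mem (h i) _

theorem prod_mul_finrank_iInf_eigenspace [FiniteDimensional ℂ V] (ρ : Representation ℂ G V)
    (hx : Pairwise fun i j => Commute (x i) (x j)) (hpow : ∀ i, x i ^ n i = 1) {μ : ι → ℂˣ}
    (hμ : ∀ i, μ i ^ n i = 1)
    (htrace : ∀ k : ι → ℕ, (∀ i, k i < n i) → k ≠ 0 →
      LinearMap.trace ℂ V (ρ (Finset.univ.noncommProd (fun i => x i ^ k i)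
        fun _ _ _ _ hij => (hx hij).pow_pow _ _)) = 0) :
    (∏ i, n i) * Module.finrank ℂ ↥(⨅ i, Module.End.eigenspace (ρ (x i)) (μ i : ℂ)) =
      Module.finrank ℂ V := by
  classical
  let y : ι → G × ℂˣ := fun i => (x i, μ i)
  have hy : Pairwise fun i j => Commute (y i) (y j) := fun i j hij =>
    Prod.ext (hx hij) (Commute.all _ _)
  have hypow : ∀ i, y i ^ n i = 1 := fun i => Prod.ext (hpow i) (hμ i)
  have hinvariants : Representation.invariants ((twistedRep ρ).comp (prodPowHom hy hypow)) =
      ⨅ i, Module.End.eigenspace (ρ (x i)) (μ i : ℂ) := by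
    ext v
    simp only [mem_invariants_comp_prodPowHom_iff, y, twistedRep_apply_eq_self_iff,
      Submodule.mem_iInf]
  rw [← hinvariants, ← card_mul_finrank_invariants ((twistedRep ρ).comp (prodPowHom hy hypow))]
  · simp [ZMod.card]
  · intro k hk
    have hfst : (prodPowHom hy hypow k).1 = Finset.univ.noncommProd
        (fun i => x i ^ (k i).toAdd.val) fun _ _ _ _ hij => (hx hij).pow_pow _ _ := by
      rw [prodPowHom_apply]
      exact Finset.map_noncommProd _ _ _ (MonoidHom.fst G ℂˣ)
    rw [MonoidHom.comp_apply, twistedRep_apply, hfst, map_smul, htrace _ fun i => ZMod.val_lt _,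
      smul_zero]
    contrapose! hk
    exact funext fun i => (ZMod.val_eq_zero _).1 (congrFun hk i)

end Multiplicity

lemma sum_range_two_mul {M : Type*} [AddCommMonoid M] (f : ℕ → M) (n : ℕ) :
    ∑ l ∈ Finset.range (2 * n), f l =
      ∑ j ∈ Finset.range n, f (2 * j) + ∑ j ∈ Finset.range n, f (2 * j + 1) := by
  induction n with
  | zero => simp
  | succ n ih =>
    rw [mul_add, mul_one, Finset.sum_range_succ, Finset.sum_range_succ, ih,
      Finset.sum_range_succ, Finset.sum_range_succ]
    abel

lemma IsWeylSystem.exists_noncommProd {A Φ G ι : Type*} [AddCommGroup A] [AddCommGroup Φ] [Group G]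
    {z : AddChar Φ (Subgroup.center G)} {B : LinearMap.BilinMap ℤ A Φ} {T : A → G}
    (hT : IsWeylSystem z B T) (v : ι → A) (k : ι → ℕ) (s : Finset ι)
    (comm : (s : Set ι).Pairwise fun i j => Commute (T (v i) ^ k i) (T (v j) ^ k j)) :
    ∃ t, s.noncommProd (fun i => T (v i) ^ k i) comm = z t * T (∑ i ∈ s, (k i : ℤ) • v i) := by
  classical
  induction s using Finset.induction_on with
  | empty => exact ⟨0, by simp [hT.map_zero]⟩
  | insert i s hi ih =>
    obtain ⟨t, ht⟩ := ih (comm.mono (Finset.coe_subset.2 (Finset.subset_insert i s)))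
    rw [Finset.noncommProd_insert_of_notMem _ _ _ _ hi, ht, ← zpow_natCast, ← hT.map_zsmul,
      mul_addChar_center_mul, hT.map_mul, addChar_center_mul_mul, Finset.sum_insert hi]
    exact ⟨_, rfl⟩

section Trace

variable {V : Type*} [NormedAddCommGroup V] [InnerProductSpace ℂ V] [FiniteDimensional ℂ V]

lemma trace_phase_mul (t : ℝ) (g : unitary (Module.End ℂ V)) :
    LinearMap.trace ℂ V (phase (Module.End ℂ V) t * g : unitary (Module.End ℂ V)) =
      exp (Real.pi * t * I) * LinearMap.trace ℂ V g := by
  rw [coe_phase_mul, map_smul, smul_eq_mul]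

lemma IsWeylSystem.trace_eq_zero {A : Type*} [AddCommGroup A] {B : LinearMap.BilinMap ℤ A ℝ}
    {T : A → unitary (Module.End ℂ V)} (hT : IsWeylSystem (phase (Module.End ℂ V)) B T) {a b : A}
    (h : ∀ n : ℤ, B a b ≠ n) : LinearMap.trace ℂ V (T a) = 0 := by
  have hconj : T a = phase (Module.End ℂ V) ((2 : ℤ) • B a b) * (T b * T a * (T b)⁻¹) := by
    rw [← mul_assoc, ← hT.mul_comm_phase, mul_inv_cancel_right]
  have htrace : LinearMap.trace ℂ V (T b * T a * (T b)⁻¹ : unitary (Module.End ℂ V)) =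
      LinearMap.trace ℂ V (T a) := by
    rw [Submonoid.coe_mul, LinearMap.trace_mul_comm, ← Submonoid.coe_mul, ← mul_assoc,
      inv_mul_cancel, one_mul]
  have hfix := trace_phase_mul ((2 : ℤ) • B a b) (T b * T a * (T b)⁻¹)
  rw [← hconj, htrace, eq_comm, mul_left_eq_self₀] at hfix
  refine hfix.resolve_left fun hone => ?_
  obtain ⟨n, hn⟩ := Complex.exp_eq_one_iff.1 hone
  refine h n ?_
  have hcast : (B a b : ℂ) = n := by
    refine mul_right_cancel₀ Complex.two_pi_I_ne_zero ?_
    rw [← hn]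
    push_cast
    ring
  exact_mod_cast hcast

end Trace

section OddSite

variable {N : ℕ}

/-- The impurity `2i - 1`, where `j : Fin N` stands for `i = j + 1`. -/
def oddSite (j : Fin N) : ZMod (2 * N) := ((2 * (j : ℕ) + 1 : ℕ) : ZMod (2 * N))

/-- The indicator vector of the even impurities. -/
def evenVec (N : ℕ) : ZMod (2 * N) → ℤ := ∑ j : Fin N, Pi.single (oddSite j + 1) 1

lemma oddSite_injective : Function.Injective (oddSite : Fin N → ZMod (2 * N)) := fun i j hij => by
  rw [oddSite, oddSite, ZMod.natCast_eq_natCast_iff', Nat.mod_eq_of_lt (by lia),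
    Nat.mod_eq_of_lt (by lia)] at hij
  exact Fin.ext (by lia)

variable [NeZero N]

lemma oddSite_add_one (j : Fin N) : oddSite (j + 1) = oddSite j + 2 := by
  rw [oddSite, oddSite, Fin.val_add, Fin.val_one', Nat.add_mod_mod, Nat.cast_succ,
    ← Nat.mul_mod_mul_left, ZMod.natCast_mod]
  push_cast
  ring

lemma siteSign_oddSite (j : Fin N) : siteSign (oddSite j) = -1 := by
  rw [oddSite, siteSign_natCast, pow_succ, pow_mul]
  simp

lemma sum_eq_sum_oddSite_add {M : Type*} [AddCommMonoid M] (f : ZMod (2 * N) → M) :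
    ∑ i, f i = ∑ j, f (oddSite j) + ∑ j, f (oddSite j + 1) := by
  simp only [oddSite, ← Nat.cast_succ]
  rw [← sum_range_natCast_succ, sum_range_two_mul,
    Fin.sum_univ_eq_sum_range fun j => f ((2 * j + 1 : ℕ) : ZMod (2 * N)),
    Fin.sum_univ_eq_sum_range fun j => f ((2 * j + 1 + 1 : ℕ) : ZMod (2 * N))]

lemma sum_single_oddSite_add_evenVec :
    ∑ j : Fin N, (Pi.single (oddSite j) 1 : ZMod (2 * N) → ℤ) + evenVec N = 1 := by
  rw [evenVec, ← sum_eq_sum_oddSite_add fun i => (Pi.single i 1 : ZMod (2 * N) → ℤ)]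
  exact Finset.univ_sum_single (1 : ZMod (2 * N) → ℤ)

lemma evenVec_sub_sum_single_oddSite :
    evenVec N - ∑ j : Fin N, (Pi.single (oddSite j) 1 : ZMod (2 * N) → ℤ) = siteSign := by
  have hsum := sum_eq_sum_oddSite_add fun i => (Pi.single i (siteSign i) : ZMod (2 * N) → ℤ)
  rw [Finset.univ_sum_single] at hsum
  simp only [siteSign_add_one, siteSign_oddSite, neg_neg, Pi.single_neg,
    Finset.sum_neg_distrib] at hsum
  rw [hsum, evenVec]
  abel

lemma sum_spinVec_oddSite :
    ∑ j : Fin N, spinVec (oddSite j) = evenVec N - 1 - (5 : ℤ) • siteSign := by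
  have hspin (j : Fin N) : spinVec (oddSite j) = (2 : ℤ) • Pi.single (oddSite j) 1 +
      (-5 : ℤ) • Pi.single (oddSite j + 1) 1 + (2 : ℤ) • Pi.single (oddSite (j + 1)) 1 := by
    rw [spinVec, siteTriple, oddSite_add_one]
    simp only [← Pi.single_smul, smul_eq_mul, mul_one]
  have hshift := Equiv.sum_comp (Equiv.addRight (1 : Fin N))
    fun j => (Pi.single (oddSite j) 1 : ZMod (2 * N) → ℤ)
  simp only [Equiv.coe_addRight] at hshift
  simp only [hspin, Finset.sum_add_distrib, ← Finset.smul_sum]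
  rw [hshift, ← evenVec_sub_sum_single_oddSite, ← sum_single_oddSite_add_evenVec, ← evenVec]
  module

end OddSite

section GapLabels

variable {N : ℕ}

/-- The exponent vectors of `K_{2N}` (the index `none`) and of the `L_i`, the generators whose joint
eigenspaces are the `EdgeTheory.jointEigenspace`. -/
def gapVec [NeZero N] : Option (Fin N) → ZMod (2 * N) → ℤ
  | none => clockVec 0
  | some j => spinVec (oddSite j)

/-- The orders of the generators with exponent vectors `gapVec`. -/
def gapOrder : Option (Fin N) → ℕ
  | none => clockOrder N
  | some _ => 2

/-- The eigenvalues of the generators with exponent vectors `gapVec` on the states labelled by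
`(m, σ_1, …, σ_N)`. -/
noncomputable def gapEigenvalue (m : ℕ) (σ : Fin N → ℤˣ) : Option (Fin N) → ℂˣ
  | none => Units.mk0 (exp (2 * Real.pi * I * m / clockOrder N)) (Complex.exp_ne_zero _)
  | some j => Units.map (Int.castRingHom ℂ) (σ j)

variable [NeZero N]

instance (i : Option (Fin N)) : NeZero (gapOrder i) := by
  cases i
  exacts [⟨(clockOrder_pos N).ne'⟩, ⟨two_ne_zero⟩]

lemma gapEigenvalue_pow_gapOrder (m : ℕ) (σ : Fin N → ℤˣ) (i : Option (Fin N)) :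
    gapEigenvalue m σ i ^ gapOrder i = 1 := by
  cases i with
  | none =>
    have hQ : (clockOrder N : ℂ) ≠ 0 := Nat.cast_ne_zero.2 (clockOrder_pos N).ne'
    refine Units.ext ?_
    rw [gapEigenvalue, gapOrder, Units.val_pow_eq_pow_val, Units.val_mk0, ← Complex.exp_nat_mul,
      mul_div_cancel₀ _ hQ, Units.val_one, Complex.exp_eq_one_iff]
    exact ⟨m, by push_cast; ring⟩
  | some j => rw [gapEigenvalue, gapOrder, ← map_pow, Int.units_sq, map_one]

lemma pairing_sum_gapVec (k : Option (Fin N) → ℕ) (b : ZMod (2 * N) → ℤ) :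
    2 * pairing 1 9 N (∑ i, (k i : ℤ) • gapVec i) b =
      k none * (2 * pairing 1 9 N (clockVec 0) b) +
        ∑ j, (k (some j) : ℝ) * (b (oddSite j) - b (oddSite j + 2)) := by
  simp only [Fintype.sum_option, gapVec, map_add, map_sum, map_smul, LinearMap.add_apply,
    LinearMap.sum_apply, LinearMap.smul_apply, ← pairing_spinVec]
  simp only [zsmul_eq_mul, Int.cast_natCast, mul_add, Finset.mul_sum, mul_left_comm (2 : ℝ)]

end GapLabels

namespace EdgeTheory

variable {N : ℕ} [NeZero N] {V : Type*} [NormedAddCommGroup V] [InnerProductSpace ℂ V]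
  [FiniteDimensional ℂ V] (𝓔 : EdgeTheory 1 9 N V)

lemma trace_weyl_evenVec : LinearMap.trace ℂ V (𝓔.weyl (evenVec N)) = 0 := by
  have htrace := 𝓔.trace_prod_even
  have hU (i : ZMod (2 * N)) := zpow_one (𝓔.U i) ▸ 𝓔.U_zpow i 1
  simp only [hU, prod_range_addChar_center_mul, 𝓔.isWeylSystem_weyl.prod_range,
    addChar_center_mul_mul, trace_phase_mul, mul_eq_zero, Complex.exp_ne_zero, false_or] at htrace
  rw [evenVec]
  simp only [oddSite, ← Nat.cast_succ]
  rwa [Fin.sum_univ_eq_sum_range fun j =>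
    (Pi.single ((2 * j + 1 + 1 : ℕ) : ZMod (2 * N)) 1 : ZMod (2 * N) → ℤ)]

lemma trace_weyl_eq_zero_of_none_ne_zero {k : Option (Fin N) → ℕ} (hk : k none < clockOrder N)
    (hk₀ : k none ≠ 0) : LinearMap.trace ℂ V (𝓔.weyl (∑ i, (k i : ℤ) • gapVec i)) = 0 := by
  have hN : 2 ≤ N := by
    by_contra! hlt
    obtain rfl : N = 1 := by have := NeZero.ne N; lia
    exact hk₀ (Nat.lt_one_iff.1 hk)
  have hodd {i : ZMod (2 * N)} (hi : siteSign i = -1) :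
      (Pi.single 2 1 : ZMod (2 * N) → ℤ) i = 0 := by
    refine Pi.single_eq_of_ne ?_ _
    rintro rfl
    have htwo := siteSign_natCast (N := N) 2
    rw [Nat.cast_ofNat, hi] at htwo
    norm_num at htwo
  refine 𝓔.isWeylSystem_weyl.trace_eq_zero (b := Pi.single 2 1) fun n hn => ?_
  have hpairing := pairing_sum_gapVec k (Pi.single 2 1)
  simp only [hn, hodd (siteSign_oddSite _), hodd ((siteSign_add_two _).trans (siteSign_oddSite _)),
    sub_self, mul_zero, Finset.sum_const_zero, add_zero] at hpairing
  have hdvd : (k none : ℝ) = clockOrder N * (-n) := by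
    linear_combination (clockOrder N : ℝ) / 2 * hpairing +
      (k none : ℝ) * pairing_clockVec_zero_single_two hN
  exact hk₀ (Nat.eq_zero_of_dvd_of_lt
    (Int.natCast_dvd_natCast.1 ⟨-n, by exact_mod_cast hdvd⟩) hk)

lemma trace_weyl_eq_zero_of_some_add_one_ne {k : Option (Fin N) → ℕ} (hk₀ : k none = 0)
    (hk : ∀ j, k (some j) < 2) {j : Fin N} (hj : k (some (j + 1)) ≠ k (some j)) :
    LinearMap.trace ℂ V (𝓔.weyl (∑ i, (k i : ℤ) • gapVec i)) = 0 := by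
  refine 𝓔.isWeylSystem_weyl.trace_eq_zero (b := Pi.single (oddSite (j + 1)) 1) fun n hn => ?_
  have hpairing := pairing_sum_gapVec k (Pi.single (oddSite (j + 1)) 1)
  simp only [hn, hk₀, Pi.single_apply, ← oddSite_add_one, oddSite_injective.eq_iff,
    add_left_inj, Nat.cast_zero, zero_mul, zero_add, Int.cast_ite, Int.cast_one, Int.cast_zero,
    mul_sub, mul_ite, mul_one, mul_zero, Finset.sum_sub_distrib, Finset.sum_ite_eq',
    Finset.mem_univ, if_true] at hpairing
  have hint : (2 * n : ℤ) = k (some (j + 1)) - k (some j) := by exact_mod_cast hpairing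
  have hlt := hk j
  have hlt' := hk (j + 1)
  lia

open scoped Fin.CommRing in
lemma trace_weyl_eq_zero_of_some_add_one_eq {k : Option (Fin N) → ℕ} (hk₀ : k none = 0)
    (hk : ∀ j, k (some j) < 2) (hne : k ≠ 0) (hconst : ∀ j, k (some (j + 1)) = k (some j)) :
    LinearMap.trace ℂ V (𝓔.weyl (∑ i, (k i : ℤ) • gapVec i)) = 0 := by
  have hall (j : Fin N) : k (some j) = k (some 0) := by
    have hperiodic : Function.Periodic (fun j => k (some j)) 1 := hconst
    simpa using hperiodic.nat_mul_eq j
  have hone : k (some 0) = 1 := by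
    have hzero : k (some 0) ≠ 0 := fun h =>
      hne (funext fun i => i.casesOn hk₀ fun j => (hall j).trans h)
    have := hk 0
    lia
  have hvec : ∑ i, (k i : ℤ) • gapVec i = -1 + ((-5 : ℤ) • siteSign + evenVec N) := by
    simp only [Fintype.sum_option, hk₀, hall, hone, gapVec, Nat.cast_zero, zero_smul, zero_add,
      Nat.cast_one, one_smul, sum_spinVec_oddSite]
    module
  have hmul := 𝓔.isWeylSystem_weyl.map_mul
  rw [hvec, eq_addChar_center_neg_mul (hmul _ _), eq_addChar_center_neg_mul (hmul _ _),
    𝓔.isWeylSystem_weyl.map_neg, 𝓔.isWeylSystem_weyl.map_zsmul, weyl_one, weyl_siteSign, inv_one,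
    one_zpow, one_mul, one_mul, trace_phase_mul, trace_phase_mul, trace_weyl_evenVec, mul_zero,
    mul_zero]

lemma trace_weyl_sum_gapVec {k : Option (Fin N) → ℕ} (hk : ∀ i, k i < gapOrder i) (hne : k ≠ 0) :
    LinearMap.trace ℂ V (𝓔.weyl (∑ i, (k i : ℤ) • gapVec i)) = 0 := by
  by_cases hk₀ : k none = 0
  · by_cases hconst : ∀ j, k (some (j + 1)) = k (some j)
    · exact 𝓔.trace_weyl_eq_zero_of_some_add_one_eq hk₀ (fun j => hk (some j)) hne hconst
    · obtain ⟨j, hj⟩ := not_forall.1 hconst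
      exact 𝓔.trace_weyl_eq_zero_of_some_add_one_ne hk₀ (fun j => hk (some j)) hj
  · exact 𝓔.trace_weyl_eq_zero_of_none_ne_zero (hk none) hk₀

lemma finrank_eq_clockOrder_mul_two_pow (𝓔 : EdgeTheory 1 9 N V) :
    Module.finrank ℂ V = clockOrder N * 2 ^ N := by
  have hsqrt : √(((1 : ℕ) : ℝ) * ((9 : ℕ) : ℝ)) = 3 := by
    rw [Real.sqrt_eq_iff_mul_self_eq_of_pos three_pos]
    norm_num
  have hpow : (8 : ℝ) ^ N = 4 ^ N * 2 ^ N := by rw [← mul_pow]; norm_num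
  have hclock : (3 * clockOrder N + 1 : ℝ) = 4 ^ N := mod_cast three_mul_clockOrder_add_one N
  have hfinrank := 𝓔.finrank_eq
  rw [degeneracy, hsqrt] at hfinrank
  norm_num at hfinrank
  rw [hpow, ← hclock] at hfinrank
  have hreal : (Module.finrank ℂ V : ℝ) = clockOrder N * 2 ^ N := by rw [hfinrank]; ring
  exact_mod_cast hreal

lemma K_eq_clock (i : ZMod (2 * N)) : 𝓔.K i = (𝓔.clock i : Module.End ℂ V) := 𝓔.K_eq i

lemma L_eq_spin (j : Fin N) : 𝓔.L j = (𝓔.spin (oddSite j) : Module.End ℂ V) := 𝓔.L_eq j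

lemma K_commute (i j : ZMod (2 * N)) : Commute (𝓔.K i) (𝓔.K j) := by
  rw [K_eq_clock, K_eq_clock]
  exact (𝓔.clock_commute i j).map (unitary (Module.End ℂ V)).subtype

lemma K_commute_L (i : ZMod (2 * N)) (j : Fin N) : Commute (𝓔.K i) (𝓔.L j) := by
  rw [K_eq_clock, L_eq_spin]
  exact (𝓔.spin_commute_clock _ i).symm.map (unitary (Module.End ℂ V)).subtype

lemma L_commute (i j : Fin N) : Commute (𝓔.L i) (𝓔.L j) := by
  rw [L_eq_spin, L_eq_spin]
  refine (𝓔.spin_commute_spin ?_).map (unitary (Module.End ℂ V)).subtype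
  rw [siteSign_oddSite, siteSign_oddSite]

lemma K_sq (i : ZMod (2 * N)) : 𝓔.K i ^ 2 = 𝓔.K (i - 1) := by
  rw [K_eq_clock, K_eq_clock, ← clock_sq, SubmonoidClass.coe_pow]

lemma K_pow_clockOrder : 𝓔.K ((2 * N : ℕ) : ZMod (2 * N)) ^ clockOrder N = 1 := by
  rw [K_eq_clock, ZMod.natCast_self, ← SubmonoidClass.coe_pow, clock_pow_clockOrder,
    OneMemClass.coe_one]

lemma L_sq (j : Fin N) : 𝓔.L j ^ 2 = 1 := by
  rw [L_eq_spin, ← SubmonoidClass.coe_pow, spin_sq, OneMemClass.coe_one]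

lemma jointEigenspace_eq_iInf (m : ℕ) (σ : Fin N → ℤˣ) :
    𝓔.jointEigenspace m σ = ⨅ i, Module.End.eigenspace
      ((unitary (Module.End ℂ V)).subtype (𝓔.weyl (gapVec i))) (gapEigenvalue m σ i : ℂ) := by
  rw [iInf_option, jointEigenspace, ZMod.natCast_self, K_eq_clock]
  simp only [L_eq_spin]
  rfl

theorem finrank_jointEigenspace (m : ℕ) (σ : Fin N → ℤˣ) :
    Module.finrank ℂ (𝓔.jointEigenspace m σ) = 1 := by
  have hcomm : Pairwise fun i j : Option (Fin N) =>
      Commute (𝓔.weyl (gapVec i)) (𝓔.weyl (gapVec j)) := by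
    rintro (_ | i) (_ | j) -
    exacts [𝓔.clock_commute 0 0, (𝓔.spin_commute_clock (oddSite j) 0).symm,
      𝓔.spin_commute_clock (oddSite i) 0,
      𝓔.spin_commute_spin ((siteSign_oddSite i).trans (siteSign_oddSite j).symm)]
  have hpow (i : Option (Fin N)) : 𝓔.weyl (gapVec i) ^ gapOrder i = 1 := by
    cases i
    exacts [𝓔.clock_pow_clockOrder, 𝓔.spin_sq _]
  have hfinrank := prod_mul_finrank_iInf_eigenspace (unitary (Module.End ℂ V)).subtype hcomm hpow
    (gapEigenvalue_pow_gapOrder m σ) fun k hk hne => by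
      obtain ⟨t, ht⟩ := 𝓔.isWeylSystem_weyl.exists_noncommProd gapVec k Finset.univ
        fun _ _ _ _ hij => (hcomm hij).pow_pow _ _
      rw [ht, Submonoid.subtype_apply, trace_phase_mul, 𝓔.trace_weyl_sum_gapVec hk hne, mul_zero]
  rw [← jointEigenspace_eq_iInf, Fintype.prod_option,
    𝓔.finrank_eq_clockOrder_mul_two_pow] at hfinrank
  simp only [gapOrder, Finset.prod_const, Finset.card_univ, Fintype.card_fin] at hfinrank
  exact (Nat.mul_eq_left (Nat.mul_pos (clockOrder_pos N) (by positivity)).ne').1 hfinrank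

lemma mem_jointEigenspace {m : ℕ} {σ : Fin N → ℤˣ} {v : V} : v ∈ 𝓔.jointEigenspace m σ ↔
    ∀ i, (𝓔.weyl (gapVec i) : Module.End ℂ V) v = (gapEigenvalue m σ i : ℂ) • v := by
  rw [jointEigenspace_eq_iInf, Submodule.mem_iInf]
  simp only [Module.End.mem_eigenspace_iff, Submonoid.subtype_apply]

end EdgeTheory

section EigenvectorsOfUnitary

variable {V : Type*} [NormedAddCommGroup V] [InnerProductSpace ℂ V] [FiniteDimensional ℂ V]
  {X : unitary (Module.End ℂ V)} {a : ℂ} {v : V}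

lemma star_apply_of_apply_eq_smul (ha : ‖a‖ = 1) (hv : (X : Module.End ℂ V) v = a • v) :
    star (X : Module.End ℂ V) v = star a • v := by
  have hX : star (X : Module.End ℂ V) (a • v) = v := by
    rw [← hv, ← Module.End.mul_apply, Unitary.coe_star_mul_self, Module.End.one_apply]
  have hstar : star a * a = 1 := by rw [Complex.star_def, Complex.conj_mul', ha]; norm_num
  calc star (X : Module.End ℂ V) v
      = (star a * a) • star (X : Module.End ℂ V) v := by rw [hstar, one_smul]
    _ = star a • v := by rw [mul_smul, ← map_smul, hX]

lemma add_star_apply_of_apply_eq_smul (ha : ‖a‖ = 1) (hv : (X : Module.End ℂ V) v = a • v) :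
    ((X : Module.End ℂ V) + star (X : Module.End ℂ V)) v = ((2 * a.re : ℝ) : ℂ) • v := by
  rw [LinearMap.add_apply, hv, star_apply_of_apply_eq_smul ha hv, ← add_smul, Complex.star_def,
    Complex.add_conj]

lemma inner_eq_zero_of_apply_eq_smul {b : ℂ} {w : V} (ha : ‖a‖ = 1) (hab : a ≠ b)
    (hv : (X : Module.End ℂ V) v = a • v) (hw : (X : Module.End ℂ V) w = b • w) :
    inner ℂ v w = 0 := by
  have hinner := LinearMap.adjoint_inner_left (X : Module.End ℂ V) w v
  rw [← LinearMap.star_eq_adjoint, star_apply_of_apply_eq_smul ha hv, hw, inner_smul_left,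
    inner_smul_right, starRingEnd_apply, star_star, mul_eq_mul_right_iff] at hinner
  exact hinner.resolve_left hab

end EigenvectorsOfUnitary

section Eigenbasis

variable {R M κ : Type*} [CommRing R] [IsDomain R] [AddCommGroup M] [Module R M]
  {T : Module.End R M} {E : κ → R}

lemma eigenspace_eq_span_of_basis (b : Module.Basis κ R M) (h : ∀ i, T (b i) = E i • b i) (μ : R) :
    T.eigenspace μ = Submodule.span R (b '' {i | E i = μ}) := by
  refine le_antisymm (fun v hv => b.mem_span_image.2 fun i hi => ?_) (Submodule.span_le.2 ?_)
  · have hcoord : b.coord i ∘ₗ T = E i • b.coord i := b.ext fun j => by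
      by_cases hij : j = i <;> simp [h, hij]
    have hrepr := LinearMap.congr_fun hcoord v
    rw [LinearMap.comp_apply, Module.End.mem_eigenspace_iff.1 hv, map_smul, LinearMap.smul_apply,
      smul_eq_mul, smul_eq_mul, b.coord_apply] at hrepr
    exact (mul_right_cancel₀ (Finsupp.mem_support_iff.1 hi) hrepr).symm
  · rintro _ ⟨i, rfl, rfl⟩
    exact Module.End.mem_eigenspace_iff.2 (h i)

lemma hasEigenvalue_iff_of_basis (b : Module.Basis κ R M) (h : ∀ i, T (b i) = E i • b i) (μ : R) :
    T.HasEigenvalue μ ↔ ∃ i, E i = μ := by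
  rw [Module.End.hasEigenvalue_iff, eigenspace_eq_span_of_basis b h, Ne, Submodule.span_eq_bot]
  simp only [Set.forall_mem_image, Set.mem_ofPred_eq, b.ne_zero, imp_false, not_forall, not_not]

end Eigenbasis

section GapEigenvalue

variable {N : ℕ}

lemma norm_gapEigenvalue [NeZero N] (m : ℕ) (σ : Fin N → ℤˣ) (i : Option (Fin N)) :
    ‖(gapEigenvalue m σ i : ℂ)‖ = 1 :=
  Complex.norm_eq_one_of_pow_eq_one (by
    rw [← Units.val_pow_eq_pow_val, gapEigenvalue_pow_gapOrder, Units.val_one]) (NeZero.ne _)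

lemma gapEigenvalue_some (m : ℕ) (σ : Fin N → ℤˣ) (j : Fin N) :
    (gapEigenvalue m σ (some j) : ℂ) = ((σ j : ℤ) : ℂ) := rfl

lemma gapEigenvalue_none (m : ℕ) (σ : Fin N → ℤˣ) :
    (gapEigenvalue m σ none : ℂ) = exp (2 * Real.pi * I / clockOrder N) ^ m := by
  rw [← Complex.exp_nat_mul, gapEigenvalue, Units.val_mk0]
  congr 1
  ring

lemma eq_of_gapEigenvalue_eq {m m' : ℕ} {σ σ' : Fin N → ℤˣ} (hm : m < clockOrder N)
    (hm' : m' < clockOrder N) (h : gapEigenvalue m σ = gapEigenvalue m' σ') :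
    m = m' ∧ σ = σ' := by
  refine ⟨(Complex.isPrimitiveRoot_exp _ (Nat.ne_zero_of_lt hm)).pow_inj hm hm' ?_,
    funext fun j => Units.ext ?_⟩
  · rw [← gapEigenvalue_none m σ, h, gapEigenvalue_none]
  · have hj := congrArg Units.val (congrFun h (some j))
    rw [gapEigenvalue_some, gapEigenvalue_some] at hj
    exact_mod_cast hj

end GapEigenvalue

namespace EdgeTheory

variable {N : ℕ} [NeZero N] {V : Type*} [NormedAddCommGroup V] [InnerProductSpace ℂ V]
  [FiniteDimensional ℂ V] (𝓔 : EdgeTheory 1 9 N V)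

theorem exists_eigenbasis : ∃ b : OrthonormalBasis (Fin (clockOrder N) × (Fin N → ℤˣ)) ℂ V,
    ∀ (m : Fin (clockOrder N)) (σ : Fin N → ℤˣ), b (m, σ) ∈ 𝓔.jointEigenspace m σ := by
  have hunit (p : Fin (clockOrder N) × (Fin N → ℤˣ)) :
      ∃ v : 𝓔.jointEigenspace p.1 p.2, ‖v‖ = 1 := by
    have : Nontrivial (𝓔.jointEigenspace p.1 p.2) :=
      Module.nontrivial_of_finrank_pos (R := ℂ) (by rw [finrank_jointEigenspace]; exact one_pos)
    exact exists_norm_eq _ zero_le_one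
  choose u hu using hunit
  have horth : Orthonormal ℂ fun p => (u p : V) := by
    refine ⟨hu, fun p q hpq => ?_⟩
    obtain ⟨i, hi⟩ : ∃ i, gapEigenvalue p.1 p.2 i ≠ gapEigenvalue q.1 q.2 i := by
      by_contra! h
      obtain ⟨hm, hσ⟩ := eq_of_gapEigenvalue_eq p.1.2 q.1.2 (funext h)
      exact hpq (Prod.ext (Fin.ext hm) hσ)
    exact inner_eq_zero_of_apply_eq_smul (norm_gapEigenvalue p.1 p.2 i) (Units.val_injective.ne hi)
      (𝓔.mem_jointEigenspace.1 (u p).2 i) (𝓔.mem_jointEigenspace.1 (u q).2 i)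
  have hcard : Fintype.card (Fin (clockOrder N) × (Fin N → ℤˣ)) = Module.finrank ℂ V := by
    simp [𝓔.finrank_eq_clockOrder_mul_two_pow]
  have : Nonempty (Fin (clockOrder N) × (Fin N → ℤˣ)) := ⟨⟨0, clockOrder_pos N⟩, 1⟩
  refine ⟨(basisOfOrthonormalOfCardEqFinrank horth hcard).toOrthonormalBasis
    (by rwa [coe_basisOfOrthonormalOfCardEqFinrank]), fun m σ => ?_⟩
  rw [Module.Basis.coe_toOrthonormalBasis, coe_basisOfOrthonormalOfCardEqFinrank]
  exact (u (m, σ)).2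

variable {m : ℕ} {σ : Fin N → ℤˣ} {v : V}

lemma clock_neg_apply (hv : v ∈ 𝓔.jointEigenspace m σ) (n : ℕ) :
    (𝓔.clock (-(n : ZMod (2 * N))) : Module.End ℂ V) v =
      exp ((2 ^ n * (2 * Real.pi * m) / clockOrder N : ℝ) * I) • v := by
  have hpow (k : ℕ) : ((𝓔.clock 0 : Module.End ℂ V) ^ k) v =
      (gapEigenvalue m σ none : ℂ) ^ k • v := by
    induction k with
    | zero => simp
    | succ k ih =>
      rw [pow_succ', Module.End.mul_apply, ih, map_smul, clock,
        show clockVec 0 = gapVec none from rfl, 𝓔.mem_jointEigenspace.1 hv none, smul_smul,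
        pow_succ]
  rw [clock_neg, SubmonoidClass.coe_pow, hpow, gapEigenvalue_none, ← Complex.exp_nat_mul,
    ← Complex.exp_nat_mul]
  congr 2
  push_cast
  ring

lemma sum_K_add_star_apply (hv : v ∈ 𝓔.jointEigenspace m σ) :
    (∑ i, (𝓔.K i + star (𝓔.K i))) v = ((∑ n ∈ Finset.range (2 * N),
      2 * Real.cos (2 ^ n * (2 * Real.pi * m) / clockOrder N) : ℝ) : ℂ) • v := by
  rw [← Equiv.sum_comp (Equiv.neg (ZMod (2 * N)))]
  simp only [Equiv.neg_apply]
  rw [← sum_range_natCast fun i => 𝓔.K (-i) + star (𝓔.K (-i)), LinearMap.sum_apply,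
    Complex.ofReal_sum, Finset.sum_smul]
  refine Finset.sum_congr rfl fun n _ => ?_
  rw [K_eq_clock, add_star_apply_of_apply_eq_smul (Complex.norm_exp_ofReal_mul_I _)
    (𝓔.clock_neg_apply hv n), Complex.exp_ofReal_mul_I_re]

lemma sum_L_add_star_apply (hv : v ∈ 𝓔.jointEigenspace m σ) :
    (∑ j, (𝓔.L j + star (𝓔.L j))) v = ((∑ j, 2 * ((σ j : ℤ) : ℝ) : ℝ) : ℂ) • v := by
  rw [LinearMap.sum_apply, Complex.ofReal_sum, Finset.sum_smul]
  refine Finset.sum_congr rfl fun j _ => ?_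
  rw [L_eq_spin, spin, show spinVec (oddSite j) = gapVec (some j) from rfl,
    add_star_apply_of_apply_eq_smul (norm_gapEigenvalue m σ (some j))
      (𝓔.mem_jointEigenspace.1 hv (some j)), gapEigenvalue_some, Complex.intCast_re]

lemma H_apply (hv : v ∈ 𝓔.jointEigenspace m σ) : 𝓔.H v = (energy N m σ : ℂ) • v := by
  rw [H, LinearMap.sub_apply, LinearMap.neg_apply, LinearMap.smul_apply, LinearMap.smul_apply,
    𝓔.sum_K_add_star_apply hv, 𝓔.sum_L_add_star_apply hv, smul_smul, smul_smul, ← neg_smul,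
    ← sub_smul, energy, ← Finset.mul_sum, ← Finset.mul_sum]
  congr 1
  push_cast
  ring

lemma K_apply (hv : v ∈ 𝓔.jointEigenspace m σ) {n : ℕ} (hn : n ≤ 2 * N) :
    𝓔.K ((2 * N - n : ℕ) : ZMod (2 * N)) v =
      exp (I * (2 ^ n * (2 * Real.pi * m) / clockOrder N)) • v := by
  rw [K_eq_clock, Nat.cast_sub hn, ZMod.natCast_self, zero_sub, 𝓔.clock_neg_apply hv, mul_comm]
  push_cast
  rfl

theorem hasEigenvalue_H_iff (μ : ℂ) : 𝓔.H.HasEigenvalue μ ↔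
    ∃ m < clockOrder N, ∃ σ : Fin N → ℤˣ, μ = (energy N m σ : ℂ) := by
  obtain ⟨b, hb⟩ := 𝓔.exists_eigenbasis
  rw [hasEigenvalue_iff_of_basis b.toBasis (E := fun p => (energy N p.1 p.2 : ℂ))
    fun p => by rw [b.coe_toBasis]; exact 𝓔.H_apply (hb p.1 p.2)]
  simp only [Prod.exists, Fin.exists_iff, eq_comm, exists_prop]

end EdgeTheory

section DistZero

variable {Q : ℕ}

/-- The distance from `x` to `0` along the cycle `ℤ/Q`. -/
def distZero (x : ZMod Q) : ℕ := x.valMinAbs.natAbs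

lemma distZero_one (hQ : 2 ≤ Q) : distZero (1 : ZMod Q) = 1 := by
  have h : (1 : ZMod Q).valMinAbs = 1 := by
    exact_mod_cast ZMod.valMinAbs_natCast_of_le_half (n := Q) (a := 1) (by omega)
  rw [distZero, h, Int.natAbs_one]

lemma distZero_pos {x : ZMod Q} (hx : x ≠ 0) : 0 < distZero x :=
  Int.natAbs_pos.2 (mt (ZMod.valMinAbs_eq_zero x).1 hx)

variable [NeZero Q]

lemma two_mul_distZero_le (x : ZMod Q) : 2 * distZero x ≤ Q := by
  have h := x.natAbs_valMinAbs_le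
  rw [distZero]
  omega

lemma valMinAbs_two_mul_of_lt {x : ZMod Q} (hx : 4 * distZero x < Q) :
    (2 * x).valMinAbs = 2 * x.valMinAbs := by
  rw [distZero] at hx
  rw [ZMod.valMinAbs_spec, Set.mem_Ioc]
  refine ⟨by rw [Int.cast_mul, ZMod.coe_valMinAbs, Int.cast_ofNat], ?_, ?_⟩ <;> omega

lemma valMinAbs_two_mul_of_le (hQ : Odd Q) {x : ZMod Q} (hx : Q ≤ 4 * distZero x) :
    (2 * x).valMinAbs = 2 * x.valMinAbs - x.valMinAbs.sign * Q := by
  have hle := two_mul_distZero_le x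
  have hQ' := hQ.pos
  obtain ⟨q, hq⟩ := hQ
  rw [distZero] at hx hle
  rw [ZMod.valMinAbs_spec, Set.mem_Ioc]
  refine ⟨by simp, ?_⟩
  rcases lt_trichotomy x.valMinAbs 0 with h | h | h
  · rw [Int.sign_eq_neg_one_of_neg h]
    omega
  · omega
  · rw [Int.sign_eq_one_of_pos h]
    omega

lemma distZero_two_mul_of_lt {x : ZMod Q} (hx : 4 * distZero x < Q) :
    distZero (2 * x) = 2 * distZero x := by
  rw [distZero, valMinAbs_two_mul_of_lt hx, Int.natAbs_mul, distZero]
  rfl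

lemma distZero_two_mul_add_of_le (hQ : Odd Q) {x : ZMod Q} (hx : Q ≤ 4 * distZero x) :
    2 * distZero x + distZero (2 * x) = Q := by
  have hle := two_mul_distZero_le x
  have hQ' := hQ.pos
  have h := valMinAbs_two_mul_of_le hQ hx
  simp only [distZero] at hx hle ⊢
  rcases lt_trichotomy x.valMinAbs 0 with hv | hv | hv
  · rw [Int.sign_eq_neg_one_of_neg hv] at h
    omega
  · omega
  · rw [Int.sign_eq_one_of_pos hv] at h
    omega

lemma distZero_two_pow_add_mul {x : ZMod Q} {m n : ℕ}
    (h : ∀ k < n, 4 * distZero (2 ^ (m + k) * x) < Q) :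
    distZero (2 ^ (m + n) * x) = 2 ^ n * distZero (2 ^ m * x) := by
  induction n with
  | zero => simp
  | succ n ih =>
    rw [← add_assoc, pow_succ' _ (m + n), mul_assoc, distZero_two_mul_of_lt (h n n.lt_succ_self),
      ih fun k hk => h k (hk.trans n.lt_succ_self), pow_succ', mul_assoc]

lemma two_pow_mul_distZero_add (hQ : Odd Q) {x : ZMod Q} {m n : ℕ}
    (h : ∀ k < n, 4 * distZero (2 ^ (m + k) * x) < Q) (hn : Q ≤ 4 * distZero (2 ^ (m + n) * x)) :
    2 ^ (n + 1) * distZero (2 ^ m * x) + distZero (2 ^ (m + n + 1) * x) = Q := by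
  rw [pow_succ', mul_assoc, ← distZero_two_pow_add_mul h, pow_succ' _ (m + n), mul_assoc]
  exact distZero_two_mul_add_of_le hQ hn

end DistZero

section PeakTimes

variable {Q : ℕ}

/-- The times `n < P` at which the orbit `2 ^ n * x` lies in the half of the cycle opposite `0`.
These are the times at which the representative of `2 ^ n * x` closest to `0` changes sign. -/
def peakTimes (P : ℕ) (x : ZMod Q) : Finset ℕ :=
  (Finset.range P).filter fun n => Q ≤ 4 * distZero (2 ^ n * x)

lemma mem_peakTimes {P n : ℕ} {x : ZMod Q} :
    n ∈ peakTimes P x ↔ n < P ∧ Q ≤ 4 * distZero (2 ^ n * x) := by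
  rw [peakTimes, Finset.mem_filter, Finset.mem_range]

lemma card_peakTimes_succ (P : ℕ) (x : ZMod Q) : (peakTimes (P + 1) x).card =
    (peakTimes P x).card + if Q ≤ 4 * distZero (2 ^ P * x) then 1 else 0 := by
  simp only [peakTimes, Finset.card_filter, Finset.sum_range_succ]

variable [NeZero Q]

lemma sign_valMinAbs_two_pow_mul (hQ : Odd Q) (x : ZMod Q) (n : ℕ) :
    (2 ^ n * x).valMinAbs.sign = (-1) ^ (peakTimes n x).card * x.valMinAbs.sign := by
  induction n with
  | zero => simp [peakTimes]
  | succ n ih =>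
    rw [card_peakTimes_succ, pow_succ', mul_assoc]
    split_ifs with h
    · rw [pow_succ', mul_assoc, ← ih, valMinAbs_two_mul_of_le hQ h]
      have hle := two_mul_distZero_le (2 ^ n * x)
      obtain ⟨q, rfl⟩ := hQ
      rw [distZero] at hle h
      rcases lt_trichotomy (2 ^ n * x).valMinAbs 0 with hv | hv | hv
      · rw [Int.sign_eq_neg_one_of_neg hv, Int.sign_eq_one_of_pos (by omega)]
        rfl
      · omega
      · rw [Int.sign_eq_one_of_pos hv, Int.sign_eq_neg_one_of_neg (by omega)]
        rfl
    · rw [valMinAbs_two_mul_of_lt (not_le.1 h), Int.sign_mul, ih, add_zero]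
      exact one_mul _

lemma even_card_peakTimes (hQ : Odd Q) {P : ℕ} (hP : (2 : ZMod Q) ^ P = 1) {x : ZMod Q}
    (hx : x ≠ 0) : Even (peakTimes P x).card := by
  have hsign := sign_valMinAbs_two_pow_mul hQ x P
  have hne : x.valMinAbs.sign ≠ 0 := by
    rwa [Ne, Int.sign_eq_zero_iff_zero, ZMod.valMinAbs_eq_zero]
  rw [hP, one_mul, eq_comm, mul_eq_right₀ hne] at hsign
  exact (neg_one_pow_eq_one_iff_even (by decide)).1 hsign

lemma exists_le_four_mul_distZero {x : ZMod Q} (hx : x ≠ 0) :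
    ∃ n, Q ≤ 4 * distZero (2 ^ n * x) := by
  by_contra! h
  have hle := two_mul_distZero_le (2 ^ Q * x)
  have hgrowth := distZero_two_pow_add_mul (m := 0) (n := Q) fun k _ => h _
  rw [zero_add, pow_zero, one_mul] at hgrowth
  nlinarith [distZero_pos hx, Q.lt_two_pow_self]

lemma two_le_card_peakTimes (hQ : Odd Q) {P : ℕ} (hP : (2 : ZMod Q) ^ P = 1) (hP0 : 0 < P)
    {x : ZMod Q} (hx : x ≠ 0) : 2 ≤ (peakTimes P x).card := by
  obtain ⟨n, hn⟩ := exists_le_four_mul_distZero hx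
  rw [pow_eq_pow_mod n hP] at hn
  have hpos := Finset.card_pos.2 ⟨_, mem_peakTimes.2 ⟨n.mod_lt hP0, hn⟩⟩
  have heven := even_card_peakTimes hQ hP hx
  rcases heven with ⟨r, hr⟩
  omega

lemma exists_run_of_card_peakTimes_eq_two (hQ : Odd Q) {P : ℕ} (hP : (2 : ZMod Q) ^ P = 1)
    {x : ZMod Q} (hcard : (peakTimes P x).card = 2) : ∃ k g h : ℕ, g + h = P ∧
      2 ^ g * distZero (2 ^ k * x) + distZero (2 ^ (k + g) * x) = Q ∧
      2 ^ h * distZero (2 ^ (k + g) * x) + distZero (2 ^ k * x) = Q := by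
  have hmod (n : ℕ) : (2 : ZMod Q) ^ (P + n) = 2 ^ n := by rw [pow_add, hP, one_mul]
  obtain ⟨a, b, hab, hpeaks⟩ : ∃ a b, a < b ∧ peakTimes P x = {a, b} := by
    obtain ⟨a, b, hne, hpeaks⟩ := Finset.card_eq_two.1 hcard
    rcases hne.lt_or_gt with hlt | hlt
    · exact ⟨a, b, hlt, hpeaks⟩
    · exact ⟨b, a, hlt, by rw [hpeaks, Finset.pair_comm]⟩
  have hmem (n : ℕ) : n < P ∧ Q ≤ 4 * distZero (2 ^ n * x) ↔ n = a ∨ n = b := by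
    rw [← mem_peakTimes, hpeaks, Finset.mem_insert, Finset.mem_singleton]
  have ha := (hmem a).2 (Or.inl rfl)
  have hb := (hmem b).2 (Or.inr rfl)
  have hnot {n : ℕ} (hn : n < P) (hna : n ≠ a) (hnb : n ≠ b) : 4 * distZero (2 ^ n * x) < Q :=
    not_le.1 fun hle => ((hmem n).1 ⟨hn, hle⟩).elim hna hnb
  obtain ⟨l, rfl⟩ : ∃ l, b = a + 1 + l := ⟨b - a - 1, by omega⟩
  obtain ⟨l', hl'⟩ : ∃ l', P + a = a + 1 + l + 1 + l' := ⟨P - l - 2, by omega⟩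
  refine ⟨a + 1, l + 1, l' + 1, by omega, two_pow_mul_distZero_add hQ (fun n hn => ?_) hb.2, ?_⟩
  · exact hnot (by omega) (by omega) (by omega)
  · have hrun := two_pow_mul_distZero_add (x := x) (m := a + 1 + l + 1) (n := l') hQ
      (fun n hn => ?_) (by rw [← hl', hmod]; exact ha.2)
    · rwa [← hl', add_assoc P, hmod] at hrun
    · rcases lt_or_ge (a + 1 + l + 1 + n) P with hlt | hle
      · exact hnot hlt (by omega) (by omega)
      · obtain ⟨j, hj⟩ := Nat.exists_eq_add_of_le hle
        rw [hj, hmod]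
        exact hnot (by omega) (by omega) (by omega)

end PeakTimes

section ClockCost

/-- Potential of the map `c ↦ 2 * c * (2 - c)`, which transports `1 - cos θ` to `1 - cos (2 * θ)`.
It is the cubic for which the estimate `three_halves_add_potential_le` is an equality, to second
order at the fixed point `3 / 2`, and along the orbit `1 ↦ 2 ↦ 0`. -/
noncomputable def potential (c : ℝ) : ℝ := c * (c - 1) * (8 * c - 13) / 12

lemma three_halves_add_potential_le {c : ℝ} (h1 : 1 ≤ c) (h2 : c ≤ 2) :
    3 / 2 + potential c ≤ c + potential (2 * c * (2 - c)) := by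
  have hfactor : c + potential (2 * c * (2 - c)) - (3 / 2 + potential c) =
      (2 * c - 3) ^ 2 * (2 - c) * (c - 1) * (1 + 16 * c ^ 2) / 12 := by
    simp only [potential]
    ring
  rw [← sub_nonneg, hfactor]
  exact div_nonneg (mul_nonneg (mul_nonneg (mul_nonneg (sq_nonneg _) (sub_nonneg.2 h2))
    (sub_nonneg.2 h1)) (by positivity)) (by norm_num)

lemma potential_le {c : ℝ} (h0 : 0 ≤ c) (h1 : c ≤ 1) :
    potential c ≤ c + potential (2 * c * (2 - c)) := by
  have h1' := sub_nonneg.2 h1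
  have hquot : 0 ≤ 1 + (4 - 2 * c) * (2 * c * (2 - c) - 1) * (8 * (2 * c * (2 - c)) - 13) / 12 -
      (c - 1) * (8 * c - 13) / 12 := by
    nlinarith [mul_nonneg h0 h1', sq_nonneg (c - 1 / 3), sq_nonneg (c ^ 2 - c / 3),
      mul_nonneg h0 (sq_nonneg (c - 1 / 3)), mul_nonneg h1' (sq_nonneg (c ^ 2 - c / 3)),
      mul_nonneg h1' (sq_nonneg (c - 1 / 3))]
  have hprod := mul_nonneg h0 hquot
  simp only [potential]
  linarith

variable {Q : ℕ} [NeZero Q]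

/-- The cost `1 - cos (2 * π * x / Q)` of the phase of a residue `x`. -/
noncomputable def clockCost (x : ZMod Q) : ℝ := 1 - (ZMod.toCircle x : ℂ).re

lemma clockCost_intCast (a : ℤ) :
    clockCost (a : ZMod Q) = 1 - Real.cos (2 * Real.pi * a / Q) := by
  rw [clockCost, ZMod.toCircle_intCast, ← Complex.exp_ofReal_mul_I_re]
  congr 3
  push_cast
  ring

lemma clockCost_natCast (a : ℕ) :
    clockCost (a : ZMod Q) = 1 - Real.cos (2 * Real.pi * a / Q) := by
  exact_mod_cast clockCost_intCast (Q := Q) a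

lemma clockCost_nonneg (x : ZMod Q) : 0 ≤ clockCost x := by
  obtain ⟨a, rfl⟩ := ZMod.intCast_surjective x
  rw [clockCost_intCast]
  exact sub_nonneg.2 (Real.cos_le_one _)

lemma clockCost_le_two (x : ZMod Q) : clockCost x ≤ 2 := by
  obtain ⟨a, rfl⟩ := ZMod.intCast_surjective x
  rw [clockCost_intCast]
  linarith [Real.neg_one_le_cos (2 * Real.pi * a / Q)]

lemma clockCost_two_mul (x : ZMod Q) : clockCost (2 * x) = 2 * clockCost x * (2 - clockCost x) := by
  obtain ⟨a, rfl⟩ := ZMod.intCast_surjective x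
  have hcast : (2 * a : ZMod Q) = ((2 * a : ℤ) : ZMod Q) := by push_cast; rfl
  have hangle : 2 * Real.pi * (2 * a : ℤ) / Q = 2 * (2 * Real.pi * a / Q) := by push_cast; ring
  rw [hcast, clockCost_intCast, clockCost_intCast, hangle, Real.cos_two_mul]
  ring

lemma clockCost_neg (x : ZMod Q) : clockCost (-x) = clockCost x := by
  obtain ⟨a, rfl⟩ := ZMod.intCast_surjective x
  rw [← Int.cast_neg, clockCost_intCast, clockCost_intCast, Int.cast_neg, mul_neg, neg_div,
    Real.cos_neg]

lemma clockCost_mul_eq_of_distZero_eq {x y : ZMod Q} (h : distZero x = distZero y) (a : ZMod Q) :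
    clockCost (a * x) = clockCost (a * y) := by
  rcases ZMod.natAbs_valMinAbs_eq_natAbs_valMinAbs.1 h with rfl | rfl
  · rfl
  · rw [mul_neg, clockCost_neg]

lemma distZero_distZero (x : ZMod Q) : distZero (distZero x : ZMod Q) = distZero x := by
  have h := two_mul_distZero_le x
  rw [distZero, ZMod.valMinAbs_natCast_of_le_half (by omega), Int.natAbs_natCast]

lemma clockCost_two_pow_mul (n : ℕ) (x : ZMod Q) :
    clockCost (2 ^ n * x) = 1 - Real.cos (2 ^ n * (2 * Real.pi * distZero x / Q)) := by
  have hangle : 2 ^ n * (2 * Real.pi * distZero x / Q) =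
      2 * Real.pi * (2 ^ n * distZero x : ℕ) / Q := by
    push_cast
    ring
  rw [hangle, ← clockCost_natCast, ← clockCost_mul_eq_of_distZero_eq (distZero_distZero x)]
  push_cast
  rfl

lemma clockCost_eq (x : ZMod Q) : clockCost x = 1 - Real.cos (2 * Real.pi * distZero x / Q) := by
  simpa using clockCost_two_pow_mul 0 x

lemma one_le_clockCost {x : ZMod Q} (hx : Q ≤ 4 * distZero x) : 1 ≤ clockCost x := by
  have hQ : (0 : ℝ) < Q := Nat.cast_pos.2 (NeZero.pos Q)
  have hlow : (Q : ℝ) ≤ 4 * distZero x := by exact_mod_cast hx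
  have hhigh : (2 * distZero x : ℝ) ≤ Q := by exact_mod_cast two_mul_distZero_le x
  have hcos : Real.cos (2 * Real.pi * distZero x / Q) ≤ 0 := by
    apply Real.cos_nonpos_of_pi_div_two_le_of_le
    · rw [le_div_iff₀ hQ]
      nlinarith [Real.pi_pos]
    · rw [div_le_iff₀ hQ]
      nlinarith [Real.pi_pos]
  rw [clockCost_eq]
  linarith

lemma clockCost_le_one {x : ZMod Q} (hx : 4 * distZero x < Q) : clockCost x ≤ 1 := by
  have hQ : (0 : ℝ) < Q := Nat.cast_pos.2 (NeZero.pos Q)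
  have hhigh : (4 * distZero x : ℝ) < Q := by exact_mod_cast hx
  have hnonneg : 0 ≤ 2 * Real.pi * distZero x / Q := by positivity
  have hcos : 0 ≤ Real.cos (2 * Real.pi * distZero x / Q) := by
    apply Real.cos_nonneg_of_neg_pi_div_two_le_of_le
    · linarith [Real.pi_pos]
    · rw [div_le_iff₀ hQ]
      nlinarith [Real.pi_pos]
  rw [clockCost_eq]
  linarith

end ClockCost

section OrbitCost

variable {Q : ℕ}

lemma two_pow_eq_one {P : ℕ} (hQ : 3 * Q + 1 = 2 ^ P) : (2 : ZMod Q) ^ P = 1 := by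
  have hcast : ((3 * Q + 1 : ℕ) : ZMod Q) = (2 ^ P : ℕ) := congrArg _ hQ
  simpa using hcast.symm

variable [NeZero Q]

/-- The total cost of the phases `2 ^ n * x` for `n < P`. -/
noncomputable def orbitCost (P : ℕ) (x : ZMod Q) : ℝ :=
  ∑ n ∈ Finset.range P, clockCost (2 ^ n * x)

lemma orbitCost_eq_of_distZero_eq {x y : ZMod Q} (h : distZero x = distZero y) (P : ℕ) :
    orbitCost P x = orbitCost P y :=
  Finset.sum_congr rfl fun _ _ => clockCost_mul_eq_of_distZero_eq h _

lemma orbitCost_add (g h : ℕ) (x : ZMod Q) :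
    orbitCost (g + h) x = orbitCost g x + orbitCost h (2 ^ g * x) := by
  simp only [orbitCost, Finset.sum_range_add, pow_add, mul_left_comm, mul_assoc]

lemma orbitCost_two_pow_mul {P : ℕ} (hP : (2 : ZMod Q) ^ P = 1) (k : ℕ) (x : ZMod Q) :
    orbitCost P (2 ^ k * x) = orbitCost P x := by
  have hleft := orbitCost_add k P x
  have hright := orbitCost_add P k x
  rw [hP, one_mul, add_comm P] at hright
  linarith

lemma three_halves_mul_card_peakTimes_le {P : ℕ} (hP : (2 : ZMod Q) ^ P = 1) (x : ZMod Q) :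
    3 / 2 * ((peakTimes P x).card : ℝ) ≤ orbitCost P x := by
  set V : ℕ → ℝ := fun n => potential (clockCost (2 ^ n * x)) with hV
  have hstep (n : ℕ) : (if Q ≤ 4 * distZero (2 ^ n * x) then 3 / 2 else 0) ≤
      clockCost (2 ^ n * x) + (V (n + 1) - V n) := by
    rw [hV]
    beta_reduce
    rw [pow_succ', mul_assoc, clockCost_two_mul]
    split_ifs with h
    · linarith [three_halves_add_potential_le (one_le_clockCost h) (clockCost_le_two _)]
    · linarith [potential_le (clockCost_nonneg _) (clockCost_le_one (not_le.1 h))]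
  have hcycle : V P - V 0 = 0 := by
    rw [hV]
    beta_reduce
    rw [hP, pow_zero, sub_self]
  calc 3 / 2 * ((peakTimes P x).card : ℝ)
      = ∑ n ∈ Finset.range P, if Q ≤ 4 * distZero (2 ^ n * x) then (3 / 2 : ℝ) else 0 := by
        rw [← Finset.sum_filter, ← peakTimes, Finset.sum_const, nsmul_eq_mul, mul_comm]
    _ ≤ ∑ n ∈ Finset.range P, (clockCost (2 ^ n * x) + (V (n + 1) - V n)) :=
        Finset.sum_le_sum fun n _ => hstep n
    _ = orbitCost P x := by
        rw [Finset.sum_add_distrib, Finset.sum_range_sub, hcycle, add_zero, orbitCost]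

lemma three_le_orbitCost (hQ : Odd Q) {P : ℕ} (hP : (2 : ZMod Q) ^ P = 1) (hP0 : 0 < P)
    {x : ZMod Q} (hx : x ≠ 0) : 3 ≤ orbitCost P x := by
  have hcard : (2 : ℝ) ≤ (peakTimes P x).card := by
    exact_mod_cast two_le_card_peakTimes hQ hP hP0 hx
  linarith [three_halves_mul_card_peakTimes_le hP x]

lemma three_le_sum_one_sub_cos {η : ℝ} (h0 : 0 ≤ η) (h1 : η ≤ Real.pi / 64) :
    3 ≤ (1 - Real.cos (Real.pi / 4 - η)) + (1 - Real.cos (2 * (Real.pi / 4 - η))) +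
      (1 - Real.cos (4 * (Real.pi / 4 - η))) := by
  have hpi := Real.pi_lt_d2
  set φ := Real.pi / 4 - η with hφ
  have hcos_two : Real.cos (2 * φ) = Real.sin (2 * η) := by
    rw [← Real.cos_pi_div_two_sub, hφ]
    congr 1
    ring
  have hcos_four : Real.cos (4 * φ) = 2 * Real.sin (2 * η) ^ 2 - 1 := by
    rw [← hcos_two, ← Real.cos_two_mul, ← mul_assoc]
    norm_num
  have hsq : 2 * Real.cos φ ^ 2 - 1 = Real.sin (2 * η) := by rw [← Real.cos_two_mul, hcos_two]
  have hsin_nonneg : 0 ≤ Real.sin (2 * η) :=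
    Real.sin_nonneg_of_nonneg_of_le_pi (by linarith) (by linarith)
  have hsin_le : Real.sin (2 * η) ≤ 1 / 10 := (Real.sin_le (by linarith)).trans (by linarith)
  have hcos_le : Real.cos φ ≤ 3 / 4 := by
    by_contra! hlt
    nlinarith
  rw [hcos_two, hcos_four]
  nlinarith

lemma three_le_orbitCost_of_run {x : ZMod Q} {g d : ℕ} (hg : 3 ≤ g)
    (h : 2 ^ g * distZero x + d = Q) (hd : 16 * d ≤ Q) : 3 ≤ orbitCost g x := by
  obtain ⟨g, rfl⟩ := Nat.exists_eq_add_of_le' hg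
  have hQ : (0 : ℝ) < Q := Nat.cast_pos.2 (NeZero.pos Q)
  have hsum : (2 : ℝ) ^ g * 8 * distZero x + d = Q := by
    rw [pow_add] at h
    exact_mod_cast h
  have hd' : (16 * d : ℝ) ≤ Q := by exact_mod_cast hd
  have hangle : 2 ^ g * (2 * Real.pi * distZero x / Q) = Real.pi / 4 - Real.pi * d / (4 * Q) := by
    field_simp
    linear_combination hsum
  have hη : Real.pi * d / (4 * Q) ≤ Real.pi / 64 := by
    rw [div_le_div_iff₀ (by positivity) (by norm_num)]
    nlinarith [Real.pi_pos]
  have hprefix : 0 ≤ orbitCost g x := Finset.sum_nonneg fun _ _ => clockCost_nonneg _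
  have hlast : 3 ≤ orbitCost 3 (2 ^ g * x) := by
    have hcost (n : ℕ) : clockCost (2 ^ n * (2 ^ g * x)) =
        1 - Real.cos (2 ^ n * (Real.pi / 4 - Real.pi * d / (4 * Q))) := by
      rw [← mul_assoc, ← pow_add, clockCost_two_pow_mul, pow_add, mul_assoc, hangle]
    have hthree := three_le_sum_one_sub_cos (by positivity) hη
    simp only [orbitCost, Finset.sum_range_succ, Finset.sum_range_zero, hcost]
    norm_num
    linarith
  rw [orbitCost_add]
  linarith

lemma four_le_of_two_pow_eq {b u : ℕ} (h : 2 ^ b = 3 * u + 1) (hu : 2 ≤ u) : 4 ≤ b := by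
  by_contra! hb
  interval_cases b <;> omega

lemma six_le_orbitCost_of_runs {x : ZMod Q} {g h : ℕ} (hQ : 3 * Q + 1 = 2 ^ (g + h))
    (hg : 2 ^ g * distZero x + distZero (2 ^ g * x) = Q)
    (hh : 2 ^ h * distZero (2 ^ g * x) + distZero x = Q)
    (hx : 2 ≤ distZero x) (hgx : 2 ≤ distZero (2 ^ g * x)) : 6 ≤ orbitCost (g + h) x := by
  have hpow_g : 2 ^ g = 3 * distZero (2 ^ g * x) + 1 := by
    refine Nat.eq_of_mul_eq_mul_right (NeZero.pos Q) ?_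
    rw [pow_add] at hQ
    zify at hQ hg hh ⊢
    linear_combination (-2 ^ g : ℤ) * hh + hg - (distZero (2 ^ g * x) : ℤ) * hQ
  have hpow_h : 2 ^ h = 3 * distZero x + 1 := by
    refine Nat.eq_of_mul_eq_mul_right (NeZero.pos Q) ?_
    rw [pow_add] at hQ
    zify at hQ hg hh ⊢
    linear_combination (-2 ^ h : ℤ) * hg + hh - (distZero x : ℤ) * hQ
  have hg4 := four_le_of_two_pow_eq hpow_g hgx
  have hh4 := four_le_of_two_pow_eq hpow_h hx
  have hg16 : 2 ^ 4 ≤ 2 ^ g := Nat.pow_le_pow_right two_pos hg4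
  have hh16 : 2 ^ 4 ≤ 2 ^ h := Nat.pow_le_pow_right two_pos hh4
  have hfirst := three_le_orbitCost_of_run (by omega) hg (by nlinarith)
  have hsecond := three_le_orbitCost_of_run (by omega) hh (by nlinarith)
  rw [orbitCost_add]
  linarith

lemma pos_of_three_mul_add_one_eq {P : ℕ} (hQ : 3 * Q + 1 = 2 ^ P) : 0 < P := by
  rw [Nat.pos_iff_ne_zero]
  rintro rfl
  have := NeZero.pos Q
  omega

lemma odd_of_three_mul_add_one_eq {P : ℕ} (hQ : 3 * Q + 1 = 2 ^ P) : Odd Q := by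
  have heven : Even (3 * Q + 1) :=
    hQ ▸ even_two.pow_of_ne_zero (pos_of_three_mul_add_one_eq hQ).ne'
  rw [Nat.odd_iff]
  rw [Nat.even_iff] at heven
  omega

lemma distZero_eq_one_or_two_le {P : ℕ} (hQ : 3 * Q + 1 = 2 ^ P) {x : ZMod Q} (hx : x ≠ 0)
    (k : ℕ) : distZero (2 ^ k * x) = distZero (1 : ZMod Q) ∨ 2 ≤ distZero (2 ^ k * x) := by
  have htwo : IsUnit (2 : ZMod Q) :=
    IsUnit.of_pow_eq_one (two_pow_eq_one hQ) (pos_of_three_mul_add_one_eq hQ).ne'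
  have hpos := distZero_pos (x := 2 ^ k * x) (by rwa [Ne, (htwo.pow k).mul_right_eq_zero])
  rw [distZero_one (by have := two_mul_distZero_le (2 ^ k * x); omega)]
  omega

lemma orbitCost_one_le_or_six_le {P : ℕ} (hQ : 3 * Q + 1 = 2 ^ P) {x : ZMod Q} (hx : x ≠ 0) :
    orbitCost P (1 : ZMod Q) ≤ orbitCost P x ∨ 6 ≤ orbitCost P x := by
  have hodd := odd_of_three_mul_add_one_eq hQ
  have hP := two_pow_eq_one hQ
  have horbit {k : ℕ} (h : distZero (2 ^ k * x) = distZero (1 : ZMod Q)) :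
      orbitCost P (1 : ZMod Q) ≤ orbitCost P x := by
    rw [← orbitCost_two_pow_mul hP k x, orbitCost_eq_of_distZero_eq h]
  obtain ⟨c, hc⟩ := even_card_peakTimes hodd hP hx
  have htwo := two_le_card_peakTimes hodd hP (pos_of_three_mul_add_one_eq hQ) hx
  obtain hcard | hcard : (peakTimes P x).card = 2 ∨ 4 ≤ (peakTimes P x).card := by omega
  · obtain ⟨k, g, h, rfl, hg, hh⟩ := exists_run_of_card_peakTimes_eq_two hodd hP hcard
    rcases distZero_eq_one_or_two_le hQ hx k with hk | hk
    · exact .inl (horbit hk)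
    rcases distZero_eq_one_or_two_le hQ hx (k + g) with hkg | hkg
    · exact .inl (horbit hkg)
    rw [add_comm k, pow_add, mul_assoc] at hg hh hkg
    exact .inr (orbitCost_two_pow_mul hP k x ▸ six_le_orbitCost_of_runs hQ hg hh hk hkg)
  · have hcard' : (4 : ℝ) ≤ (peakTimes P x).card := by exact_mod_cast hcard
    exact .inr (by linarith [three_halves_mul_card_peakTimes_le hP x])

end OrbitCost

section DyadicCosSum

/-- The function `F x = ∑ n, (1 - cos (x / 2 ^ n))`; its differences `F (2 ^ k * x) - F x` are the
energies of the angle-doubling orbits of length `k`. -/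
noncomputable def dyadicCosSum (x : ℝ) : ℝ := ∑' n : ℕ, (1 - Real.cos (x / 2 ^ n))

lemma one_sub_cos_div_two_pow_le (x : ℝ) (n : ℕ) :
    1 - Real.cos (x / 2 ^ n) ≤ x ^ 2 / 2 * (1 / 4) ^ n := by
  have hsq : (x / 2 ^ n) ^ 2 = x ^ 2 * (1 / 4) ^ n := by
    rw [div_pow, ← pow_mul, mul_comm n, pow_mul, one_div_pow]
    norm_num [div_eq_mul_inv]
  linarith [Real.one_sub_sq_div_two_le_cos (x := x / 2 ^ n)]

lemma hasSum_sq_div_two_mul_geometric (x : ℝ) :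
    HasSum (fun n : ℕ => x ^ 2 / 2 * (1 / 4) ^ n) (2 / 3 * x ^ 2) := by
  have hgeom : HasSum (fun n : ℕ => (1 / 4 : ℝ) ^ n) (1 - 1 / 4)⁻¹ :=
    hasSum_geometric_of_lt_one (by norm_num) (by norm_num)
  have hval : 2 / 3 * x ^ 2 = x ^ 2 / 2 * (1 - 1 / 4)⁻¹ := by ring
  exact hval ▸ hgeom.mul_left _

lemma summable_one_sub_cos_div_two_pow (x : ℝ) :
    Summable fun n : ℕ => 1 - Real.cos (x / 2 ^ n) :=
  (hasSum_sq_div_two_mul_geometric x).summable.of_nonneg_of_le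
    (fun _ => sub_nonneg.2 (Real.cos_le_one _)) (one_sub_cos_div_two_pow_le x)

lemma dyadicCosSum_nonneg (x : ℝ) : 0 ≤ dyadicCosSum x :=
  tsum_nonneg fun _ => sub_nonneg.2 (Real.cos_le_one _)

lemma dyadicCosSum_le (x : ℝ) : dyadicCosSum x ≤ 2 / 3 * x ^ 2 :=
  hasSum_le (one_sub_cos_div_two_pow_le x) (summable_one_sub_cos_div_two_pow x).hasSum
    (hasSum_sq_div_two_mul_geometric x)

lemma dyadicCosSum_eq_sum_add (x : ℝ) (k : ℕ) : dyadicCosSum x =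
    ∑ n ∈ Finset.range k, (1 - Real.cos (x / 2 ^ n)) + dyadicCosSum (x / 2 ^ k) := by
  rw [dyadicCosSum, ← (summable_one_sub_cos_div_two_pow x).sum_add_tsum_nat_add k, dyadicCosSum]
  simp only [add_comm _ k, pow_add, div_div]

lemma dyadicCosSum_eq_add_half (x : ℝ) :
    dyadicCosSum x = 1 - Real.cos x + dyadicCosSum (x / 2) := by
  simpa using dyadicCosSum_eq_sum_add x 1

lemma sum_one_sub_cos_two_pow_mul (x : ℝ) (k : ℕ) :
    ∑ n ∈ Finset.range k, (1 - Real.cos (2 ^ n * (2 * x))) =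
      dyadicCosSum (2 ^ k * x) - dyadicCosSum x := by
  induction k with
  | zero => simp
  | succ k ih =>
    rw [Finset.sum_range_succ, ih, dyadicCosSum_eq_add_half (2 ^ (k + 1) * x)]
    ring_nf

lemma lipschitzWith_dyadicCosSum : LipschitzWith 2 dyadicCosSum := by
  refine LipschitzWith.of_dist_le_mul fun x y => ?_
  have hgeom : HasSum (fun n : ℕ => dist x y * (1 / 2) ^ n) (dist x y * 2) :=
    hasSum_geometric_two.mul_left _
  rw [Real.dist_eq, dyadicCosSum, dyadicCosSum, mul_comm,
    ← (summable_one_sub_cos_div_two_pow x).tsum_sub (summable_one_sub_cos_div_two_pow y)]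
  refine tsum_of_norm_bounded (E := ℝ) hgeom fun n => ?_
  calc ‖1 - Real.cos (x / 2 ^ n) - (1 - Real.cos (y / 2 ^ n))‖
      = |Real.cos (x / 2 ^ n) - Real.cos (y / 2 ^ n)| := by
        rw [sub_sub_sub_cancel_left, Real.norm_eq_abs, abs_sub_comm]
    _ ≤ |x / 2 ^ n - y / 2 ^ n| := Real.abs_cos_sub_cos_le _ _
    _ = dist x y * (1 / 2) ^ n := by
        rw [← sub_div, abs_div, Real.dist_eq, abs_of_pos (by positivity : (0 : ℝ) < 2 ^ n),
          div_eq_mul_inv, one_div_pow, one_div]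

lemma dyadicCosSum_zero : dyadicCosSum 0 = 0 := by simp [dyadicCosSum]

lemma dyadicCosSum_four_mul_le {y : ℝ} (h1 : 3 * Real.pi / 4 ≤ y) (h2 : y ≤ 4 * Real.pi / 5) :
    dyadicCosSum (4 * y) ≤ 6 := by
  have hcos_y : -((1 + √5) / 4) ≤ Real.cos y := by
    rw [← Real.cos_pi_div_five, ← Real.cos_pi_sub]
    exact Real.cos_le_cos_of_nonneg_of_le_pi (by linarith [Real.pi_pos]) (by linarith [Real.pi_pos])
      (by linarith)
  have hcos_two : 0 ≤ Real.cos (2 * y) := by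
    rw [← Real.cos_sub_two_pi]
    apply Real.cos_nonneg_of_neg_pi_div_two_le_of_le <;> linarith [Real.pi_pos]
  have hsqrt : √5 ≤ 2.24 := by
    rw [Real.sqrt_le_left (by norm_num)]
    norm_num
  have htail := dyadicCosSum_le (y / 2)
  have hy : y ^ 2 ≤ 2.52 ^ 2 :=
    pow_le_pow_left₀ (by linarith [Real.pi_pos]) (by linarith [Real.pi_lt_d2]) 2
  have hfour : 4 * y / 2 = 2 * y := by ring
  have htwo : 2 * y / 2 = y := by ring
  rw [dyadicCosSum_eq_add_half (4 * y), hfour, dyadicCosSum_eq_add_half (2 * y), htwo,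
    dyadicCosSum_eq_add_half y]
  linarith [Real.neg_one_le_cos (4 * y)]

end DyadicCosSum

section DyadicCosSumThreePi

lemma cos_mem_Icc_of_cos_two_mul_mem_Icc {x a b l u : ℝ} (h : Real.cos (2 * x) ∈ Set.Icc a b)
    (hx : 0 ≤ Real.cos x) (hl : 2 * l ^ 2 - 1 ≤ a) (hu0 : 0 ≤ u) (hu : b ≤ 2 * u ^ 2 - 1) :
    Real.cos x ∈ Set.Icc l u := by
  rw [Real.cos_two_mul] at h
  constructor
  · exact le_of_not_gt fun hlt => by nlinarith [h.1]
  · exact le_of_not_gt fun hlt => by nlinarith [h.2]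

lemma cos_three_pi_div_two_pow_succ_mem_Icc {k : ℕ} (hk : 2 ≤ k) {a b l u : ℝ}
    (h : Real.cos (3 * Real.pi / 2 ^ k) ∈ Set.Icc a b) (hl : 2 * l ^ 2 - 1 ≤ a) (hu0 : 0 ≤ u)
    (hu : b ≤ 2 * u ^ 2 - 1) : Real.cos (3 * Real.pi / 2 ^ (k + 1)) ∈ Set.Icc l u := by
  have hdouble : 3 * Real.pi / 2 ^ k = 2 * (3 * Real.pi / 2 ^ (k + 1)) := by
    rw [pow_succ]
    field_simp
  have hpow : (2 : ℝ) ^ 3 ≤ 2 ^ (k + 1) := pow_le_pow_right₀ one_le_two (by omega)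
  have hnonneg : 0 ≤ 3 * Real.pi / 2 ^ (k + 1) := by positivity
  rw [hdouble] at h
  refine cos_mem_Icc_of_cos_two_mul_mem_Icc h ?_ hl hu0 hu
  apply Real.cos_nonneg_of_neg_pi_div_two_le_of_le
  · linarith [Real.pi_pos]
  · rw [div_le_div_iff₀ (by positivity) two_pos]
    nlinarith [Real.pi_pos]

lemma cos_three_pi : Real.cos (3 * Real.pi) = -1 := by
  rw [← Real.cos_sub_two_pi, ← Real.cos_pi]
  ring_nf

lemma cos_three_pi_div_two : Real.cos (3 * Real.pi / 2) = 0 := by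
  rw [← neg_eq_zero, ← Real.cos_sub_pi, ← Real.cos_pi_div_two]
  ring_nf

lemma cos_three_pi_div_four : Real.cos (3 * Real.pi / 4) = -(√2 / 2) := by
  rw [← Real.cos_pi_div_four, ← Real.cos_pi_sub]
  ring_nf

lemma sum_one_sub_cos_three_pi_mem_Icc :
    ∑ n ∈ Finset.range 7, (1 - Real.cos (3 * Real.pi / 2 ^ n)) ∈ Set.Icc 5.546 5.5475 := by
  have hsqrt : √2 ∈ Set.Icc (1.41421 : ℝ) 1.41422 :=
    ⟨Real.le_sqrt_of_sq_le (by norm_num), Real.sqrt_le_iff.2 (by norm_num)⟩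
  have h0 : Real.cos (3 * Real.pi / 2 ^ 0) = -1 := by rw [pow_zero, div_one, cos_three_pi]
  have h1 : Real.cos (3 * Real.pi / 2 ^ 1) = 0 := by rw [pow_one, cos_three_pi_div_two]
  have h2 : Real.cos (3 * Real.pi / 2 ^ 2) ∈ Set.Icc (-0.70711) (-0.7071) := by
    norm_num [cos_three_pi_div_four] at hsqrt ⊢
    constructor <;> linarith
  have h3 : Real.cos (3 * Real.pi / 2 ^ 3) ∈ Set.Icc 0.38267 0.3827 :=
    cos_three_pi_div_two_pow_succ_mem_Icc le_rfl h2 (by norm_num) (by norm_num) (by norm_num)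
  have h4 : Real.cos (3 * Real.pi / 2 ^ 4) ∈ Set.Icc 0.83145 0.8315 :=
    cos_three_pi_div_two_pow_succ_mem_Icc (by norm_num) h3 (by norm_num) (by norm_num) (by norm_num)
  have h5 : Real.cos (3 * Real.pi / 2 ^ 5) ∈ Set.Icc 0.9569 0.957 :=
    cos_three_pi_div_two_pow_succ_mem_Icc (by norm_num) h4 (by norm_num) (by norm_num) (by norm_num)
  have h6 : Real.cos (3 * Real.pi / 2 ^ 6) ∈ Set.Icc 0.98916 0.9892 :=
    cos_three_pi_div_two_pow_succ_mem_Icc (by norm_num) h5 (by norm_num) (by norm_num) (by norm_num)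
  simp only [Finset.sum_range_succ, Finset.sum_range_zero, h0, h1]
  rw [Set.mem_Icc] at *
  norm_num at *
  constructor <;> linarith

lemma abs_dyadicCosSum_three_pi_sub_lt : |dyadicCosSum (3 * Real.pi) - 5.55| < 0.005 := by
  obtain ⟨hlow, hhigh⟩ := sum_one_sub_cos_three_pi_mem_Icc
  have htail_nonneg := dyadicCosSum_nonneg (3 * Real.pi / 2 ^ 7)
  have htail_le : dyadicCosSum (3 * Real.pi / 2 ^ 7) ≤ 2 / 3 * (3 * 3.15 / 2 ^ 7) ^ 2 :=
    (dyadicCosSum_le _).trans (by gcongr; exact Real.pi_lt_d2.le)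
  rw [dyadicCosSum_eq_sum_add _ 7, abs_lt]
  norm_num at *
  constructor <;> linarith

end DyadicCosSumThreePi

section ClockGap

lemma clockGap_eq (N m : ℕ) : clockGap N m =
    ∑ n ∈ Finset.range (2 * N), (1 - Real.cos (2 ^ n * (2 * Real.pi * m) / clockOrder N)) := by
  simp only [clockGap, energy, Finset.sum_sub_distrib, CharP.cast_eq_zero, mul_zero, zero_div,
    Real.cos_zero]
  ring

lemma clockGap_eq_orbitCost (N m : ℕ) [NeZero (clockOrder N)] :
    clockGap N m = orbitCost (2 * N) (m : ZMod (clockOrder N)) := by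
  rw [clockGap_eq, orbitCost]
  refine Finset.sum_congr rfl fun n _ => ?_
  have hcast : (2 ^ n * m : ZMod (clockOrder N)) = (2 ^ n * m : ℕ) := by push_cast; rfl
  rw [hcast, clockCost_natCast]
  push_cast
  ring_nf

lemma three_mul_clockOrder_add_one_eq_two_pow (N : ℕ) : 3 * clockOrder N + 1 = 2 ^ (2 * N) := by
  rw [three_mul_clockOrder_add_one, show (4 : ℕ) = 2 ^ 2 from rfl, ← pow_mul]

lemma natCast_ne_zero_of_pos_of_lt {Q m : ℕ} (h0 : 0 < m) (hm : m < Q) : (m : ZMod Q) ≠ 0 := by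
  rw [Ne, ZMod.natCast_eq_zero_iff]
  exact Nat.not_dvd_of_pos_of_lt h0 hm

lemma three_le_clockGap {N m : ℕ} (h0 : 0 < m) (hm : m < clockOrder N) : 3 ≤ clockGap N m := by
  have : NeZero (clockOrder N) := ⟨by omega⟩
  have hQ := three_mul_clockOrder_add_one_eq_two_pow N
  rw [clockGap_eq_orbitCost]
  exact three_le_orbitCost (odd_of_three_mul_add_one_eq hQ) (two_pow_eq_one hQ)
    (pos_of_three_mul_add_one_eq hQ) (natCast_ne_zero_of_pos_of_lt h0 hm)

lemma clockGap_one_eq (N : ℕ) [NeZero N] : clockGap N 1 =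
    dyadicCosSum (3 * Real.pi + Real.pi / clockOrder N) -
      dyadicCosSum (Real.pi / clockOrder N) := by
  have hQ : (clockOrder N : ℝ) ≠ 0 := Nat.cast_ne_zero.2 (clockOrder_pos N).ne'
  have hpow : (3 * clockOrder N + 1 : ℝ) = 2 ^ (2 * N) := by
    exact_mod_cast three_mul_clockOrder_add_one_eq_two_pow N
  have hangle : 3 * Real.pi + Real.pi / clockOrder N = 2 ^ (2 * N) * (Real.pi / clockOrder N) := by
    rw [← hpow]
    field_simp
  rw [hangle, ← sum_one_sub_cos_two_pow_mul, clockGap_eq]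
  simp only [Nat.cast_one, mul_one, mul_div_assoc]

lemma five_le_clockOrder {N : ℕ} (hN : 2 ≤ N) : 5 ≤ clockOrder N := by
  have h := three_mul_clockOrder_add_one N
  have hpow : 4 ^ 2 ≤ 4 ^ N := Nat.pow_le_pow_right (by norm_num) hN
  omega

lemma clockGap_one_le_six {N : ℕ} (hN : 2 ≤ N) : clockGap N 1 ≤ 6 := by
  have : NeZero N := ⟨by omega⟩
  have hQ : (5 : ℝ) ≤ clockOrder N := by exact_mod_cast five_le_clockOrder hN
  have hnonneg : 0 ≤ Real.pi / clockOrder N := by positivity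
  have hle : Real.pi / clockOrder N ≤ Real.pi / 5 := by gcongr
  have hsix := dyadicCosSum_four_mul_le (y := (3 * Real.pi + Real.pi / clockOrder N) / 4)
    (by linarith) (by linarith)
  rw [mul_div_cancel₀ _ four_ne_zero] at hsix
  rw [clockGap_one_eq]
  linarith [dyadicCosSum_nonneg (Real.pi / clockOrder N)]

lemma clockGap_one_le {N m : ℕ} (h0 : 0 < m) (hm : m < clockOrder N) :
    clockGap N 1 ≤ clockGap N m := by
  have : NeZero (clockOrder N) := ⟨by omega⟩
  have hN : 2 ≤ N := by
    by_contra! h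
    interval_cases N <;> norm_num [clockOrder] at hm; omega
  rcases orbitCost_one_le_or_six_le (three_mul_clockOrder_add_one_eq_two_pow N)
    (natCast_ne_zero_of_pos_of_lt h0 hm) with h | h
  · simpa only [clockGap_eq_orbitCost, Nat.cast_one] using h
  · exact (clockGap_one_le_six hN).trans (clockGap_eq_orbitCost N m ▸ h)

lemma tendsto_pi_div_clockOrder :
    Filter.Tendsto (fun N => Real.pi / clockOrder N) Filter.atTop (𝓝 0) := by
  have hle (N : ℕ) : N ≤ clockOrder N := by
    have h := three_mul_clockOrder_add_one N
    have hpow : 1 + (N : ℤ) * 3 ≤ (1 + 3) ^ N := one_add_mul_le_pow (by norm_num) N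
    zify at h ⊢
    norm_num at hpow
    linarith
  exact (tendsto_natCast_atTop_atTop.comp
    (Filter.tendsto_atTop_mono hle Filter.tendsto_id)).const_div_atTop _

lemma tendsto_clockGap_one :
    Filter.Tendsto (fun N => clockGap N 1) Filter.atTop (𝓝 (dyadicCosSum (3 * Real.pi))) := by
  have hcont := lipschitzWith_dyadicCosSum.continuous
  have hsmall := (hcont.tendsto 0).comp tendsto_pi_div_clockOrder
  have hlarge := (hcont.tendsto _).comp (tendsto_pi_div_clockOrder.const_add (3 * Real.pi))
  have hlim := hlarge.sub hsmall
  rw [dyadicCosSum_zero, sub_zero, add_zero] at hlim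
  refine hlim.congr' ?_
  filter_upwards [Filter.eventually_ne_atTop 0] with N hN
  have : NeZero N := ⟨hN⟩
  exact (clockGap_one_eq N).symm

end ClockGap

section Energies

variable {N : ℕ}

lemma energy_eq (m : ℕ) (σ : Fin N → ℤˣ) :
    energy N m σ = energy N 0 1 + clockGap N m + ∑ i, (1 - (((σ i : ℤˣ) : ℤ) : ℝ)) := by
  rw [clockGap, Finset.sum_sub_distrib, energy, energy, energy]
  simp only [Pi.one_apply, Units.val_one, Int.cast_one]
  ring

lemma clockGap_zero : clockGap N 0 = 0 := sub_self _

lemma one_sub_units_nonneg (s : ℤˣ) : 0 ≤ 1 - ((s : ℤ) : ℝ) := by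
  rcases Int.units_eq_one_or s with rfl | rfl <;> norm_num

lemma energy_flip (j : Fin N) : energy N 0 (Function.update 1 j (-1)) - energy N 0 1 = 2 := by
  rw [energy_eq 0 (Function.update 1 j (-1)), clockGap_zero, Finset.sum_eq_single j]
  · rw [Function.update_self, Units.val_neg, Units.val_one]
    norm_num
  · intro i _ hi
    rw [Function.update_of_ne hi, Pi.one_apply, Units.val_one, Int.cast_one, sub_self]
  · simp

lemma two_le_sum_one_sub_units {σ : Fin N → ℤˣ} (hσ : σ ≠ 1) :
    2 ≤ ∑ i, (1 - (((σ i : ℤˣ) : ℤ) : ℝ)) := by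
  obtain ⟨j, hj⟩ := Function.ne_iff.1 hσ
  have hflip : 1 - (((σ j : ℤˣ) : ℤ) : ℝ) = 2 := by
    rw [(Int.units_eq_one_or _).resolve_left hj, Units.val_neg, Units.val_one]
    norm_num
  exact hflip ▸ Finset.single_le_sum (f := fun i => 1 - (((σ i : ℤˣ) : ℤ) : ℝ))
    (fun i _ => one_sub_units_nonneg _) (Finset.mem_univ j)

lemma energy_add_two_le {m : ℕ} (hm : m < clockOrder N) {σ : Fin N → ℤˣ}
    (h : ¬ (m = 0 ∧ σ = 1)) : energy N 0 1 + 2 ≤ energy N m σ := by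
  rw [energy_eq m σ]
  rcases Nat.eq_zero_or_pos m with rfl | h0
  · rw [clockGap_zero]
    linarith [two_le_sum_one_sub_units fun hσ => h ⟨rfl, hσ⟩]
  · have hspin : 0 ≤ ∑ i, (1 - (((σ i : ℤˣ) : ℤ) : ℝ)) :=
      Finset.sum_nonneg fun i _ => one_sub_units_nonneg _
    linarith [three_le_clockGap h0 hm]

end Energies

namespace EdgeTheory

variable {N : ℕ} [NeZero N] {V : Type*} [NormedAddCommGroup V] [InnerProductSpace ℂ V]
  [FiniteDimensional ℂ V] (𝓔 : EdgeTheory 1 9 N V)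

theorem eigenspace_H_ground :
    𝓔.H.eigenspace (energy N 0 1 : ℂ) = 𝓔.jointEigenspace 0 1 := by
  obtain ⟨b, hb⟩ := 𝓔.exists_eigenbasis
  refine le_antisymm ?_ fun v hv => Module.End.mem_eigenspace_iff.2 (𝓔.H_apply hv)
  have hlabel : {p : Fin (clockOrder N) × (Fin N → ℤˣ) |
      (energy N p.1 p.2 : ℂ) = (energy N 0 1 : ℂ)} ⊆ {(⟨0, clockOrder_pos N⟩, 1)} := by
    rintro ⟨m, σ⟩ hp
    have henergy : energy N m σ = energy N 0 1 := by exact_mod_cast hp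
    by_contra hne
    have := energy_add_two_le m.2 (σ := σ) fun h => hne (Prod.ext (Fin.ext h.1) h.2)
    linarith
  rw [eigenspace_eq_span_of_basis b.toBasis (E := fun p => (energy N p.1 p.2 : ℂ))
    (by simpa using fun m σ => 𝓔.H_apply (hb m σ)), Submodule.span_le]
  rintro _ ⟨p, hp, rfl⟩
  obtain rfl := hlabel hp
  simpa using hb ⟨0, clockOrder_pos N⟩ 1

theorem isLeast_gap :
    IsLeast {δ : ℝ | 0 < δ ∧ 𝓔.H.HasEigenvalue ((energy N 0 1 + δ : ℝ) : ℂ)} 2 := by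
  constructor
  · refine ⟨two_pos, (𝓔.hasEigenvalue_H_iff _).2
      ⟨0, clockOrder_pos N, Function.update 1 ⟨0, NeZero.pos N⟩ (-1), ?_⟩⟩
    rw [← energy_flip (⟨0, NeZero.pos N⟩ : Fin N), add_sub_cancel]
  · rintro δ ⟨hδ, h⟩
    obtain ⟨m, hm, σ, hμ⟩ := (𝓔.hasEigenvalue_H_iff _).1 h
    have henergy : energy N 0 1 + δ = energy N m σ := by exact_mod_cast hμ
    have hgap := energy_add_two_le hm (σ := σ) (by rintro ⟨rfl, rfl⟩; linarith)
    linarith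

end EdgeTheory

end ImpurityEdge

theorem mainTheorem4 :
    -- every (1, 9) edge theory with 2N impurities
    (∀ (N : ℕ) [NeZero N] (V : Type*) [NormedAddCommGroup V] [InnerProductSpace ℂ V]
      [FiniteDimensional ℂ V] (𝓔 : EdgeTheory 1 9 N V),
      -- commutation relations
      (∀ i j, Commute (𝓔.K i) (𝓔.K j)) ∧ (∀ i j, Commute (𝓔.K i) (𝓔.L j)) ∧
      (∀ i j, Commute (𝓔.L i) (𝓔.L j)) ∧
      -- K_i ^ 2 = K_{i-1}, K_{2N} ^ Q = 1 with Q = (4 ^ N - 1) / 3, L_i ^ 2 = 1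
      (∀ i, 𝓔.K i ^ 2 = 𝓔.K (i - 1)) ∧
      3 * clockOrder N = 4 ^ N - 1 ∧
      𝓔.K ((2 * N : ℕ) : ZMod (2 * N)) ^ clockOrder N = 1 ∧
      (∀ j, 𝓔.L j ^ 2 = 1) ∧
      -- every joint eigenspace is one-dimensional
      (∀ m < clockOrder N, ∀ σ : Fin N → ℤˣ, Module.finrank ℂ (𝓔.jointEigenspace m σ) = 1) ∧
      -- the joint eigenvectors form an orthonormal basis of the Hilbert space
      (∃ b : OrthonormalBasis (Fin (clockOrder N) × (Fin N → ℤˣ)) ℂ V,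
        ∀ (m : Fin (clockOrder N)) (σ : Fin N → ℤˣ), b (m, σ) ∈ 𝓔.jointEigenspace m σ) ∧
      -- K_{2N-n} has eigenvalue e^{i 2^n 2πm/Q}, and H_gap has energy E(m, σ)
      (∀ m < clockOrder N, ∀ σ : Fin N → ℤˣ, ∀ v ∈ 𝓔.jointEigenspace m σ,
        (∀ n < 2 * N, 𝓔.K ((2 * N - n : ℕ) : ZMod (2 * N)) v =
          exp (I * (2 ^ n * (2 * Real.pi * m) / clockOrder N)) • v) ∧
        𝓔.H v = (energy N m σ : ℂ) • v) ∧
      -- the spectrum of H_gap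
      (∀ μ : ℂ, 𝓔.H.HasEigenvalue μ ↔
        ∃ m < clockOrder N, ∃ σ : Fin N → ℤˣ, μ = (energy N m σ : ℂ)) ∧
      -- the ground state is unique: m = 0 and all σ_i = +1
      (∀ m < clockOrder N, ∀ σ : Fin N → ℤˣ, ¬ (m = 0 ∧ σ = 1) → energy N 0 1 < energy N m σ) ∧
      𝓔.H.eigenspace (energy N 0 1 : ℂ) = 𝓔.jointEigenspace 0 1 ∧
      Module.finrank ℂ (𝓔.H.eigenspace (energy N 0 1 : ℂ)) = 1 ∧
      -- a single spin flip costs energy 2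
      (∀ j, energy N 0 (Function.update 1 j (-1)) - energy N 0 1 = 2) ∧
      -- the clock excitation energies, the lowest of which occurs at m = 1
      (∀ m < clockOrder N, clockGap N m =
        ∑ n ∈ Finset.range (2 * N), (1 - Real.cos (2 ^ n * (2 * Real.pi * m) / clockOrder N))) ∧
      (∀ m < clockOrder N, m ≠ 0 → clockGap N 1 ≤ clockGap N m) ∧
      -- the energy gap of H_gap is min (Δ_flip, Δ_clock(1)) = 2
      (2 ≤ N → min 2 (clockGap N 1) = 2) ∧
      IsLeast {δ : ℝ | 0 < δ ∧ 𝓔.H.HasEigenvalue ((energy N 0 1 + δ : ℝ) : ℂ)} 2) ∧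
    -- the thermodynamic limit of the lowest clock excitation energy
    (∃ S : ℝ, HasSum (fun n : ℕ => 1 - Real.cos (3 * Real.pi / 2 ^ n)) S ∧
      Filter.Tendsto (fun N : ℕ => clockGap N 1) Filter.atTop (𝓝 S) ∧ |S - 5.55| < 0.005) := by
  refine ⟨?_, dyadicCosSum (3 * Real.pi), (summable_one_sub_cos_div_two_pow _).hasSum,
    tendsto_clockGap_one, abs_dyadicCosSum_three_pi_sub_lt⟩
  intro N _ V _ _ _ 𝓔
  refine ⟨𝓔.K_commute, 𝓔.K_commute_L, 𝓔.L_commute, 𝓔.K_sq, three_mul_clockOrder N,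
    𝓔.K_pow_clockOrder, 𝓔.L_sq, fun m _ σ => 𝓔.finrank_jointEigenspace m σ, 𝓔.exists_eigenbasis,
    fun m _ σ v hv => ⟨fun n hn => 𝓔.K_apply hv hn.le, 𝓔.H_apply hv⟩, 𝓔.hasEigenvalue_H_iff,
    fun m hm σ h => ?_, 𝓔.eigenspace_H_ground, ?_, energy_flip, fun m _ => clockGap_eq N m,
    fun m hm hm0 => clockGap_one_le (Nat.pos_of_ne_zero hm0) hm, fun h2 => min_eq_left ?_,
    𝓔.isLeast_gap⟩
  · linarith [energy_add_two_le hm h]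
  · rw [𝓔.eigenspace_H_ground, 𝓔.finrank_jointEigenspace]
  · have hQ := five_le_clockOrder h2
    linarith [three_le_clockGap one_pos (show 1 < clockOrder N by omega)]
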